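/- A Bernstein function is a smooth $\Phi:(0,\infty)\to[0,\infty)$ with $(-1)^n\Phi^{(n)}\le 0$ for all $n\ge 1$. Its Lévy triple $(a_\Phi,b_\Phi,\nu_\Phi)$ consists of $a_\Phi,b_\Phi\ge 0$ and a measure $\nu_\Phi$ on $(0,\infty)$ with $\int (1\wedge x)\,\nu_\Phi(dx)<\infty$ such that $\Phi(z)=a_\Phi+b_\Phi z+\int_0^\infty(1-e^{-zx})\,\nu_\Phi(dx)$ for $z>0$; write $\bar\nu_\Phi(t)=\nu_\Phi(t,\infty)$. $\Phi$ is special if $\Phi\neq 0$ on $(0,\infty)$ and $z\mapsto z/\Phi(z)$ is again a Bernstein function. Let $\sigma_\Phi$ be a subordinator (a non-decreasing Lévy process) with $\mathbb E[e^{-z\sigma_\Phi(t)}]=e^{-t\Phi(z)}$ for $t\ge 0$, $z>0$, let $U_\Phi(A)=\mathbb E\left[\int_0^\infty \mathbf 1_A(\sigma_\Phi(s))\,ds\right]$ be its potential measure and $u_\Phi$ the Lebesgue density of $U_\Phi$ (the potential density). **Theorem.** Let $\Phi$ be a special Bernstein function with $a_\Phi=b_\Phi=0$ and $\nu_\Phi(0,\infty)=\infty$,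 and suppose there are $\beta\in(0,1)$, $t_0>0$ and $C>0$ with $u_\Phi(t)\le C t^{\beta-1}$ for almost every $t\in(0,t_0)$. Let $X$ be a Banach space, $T>0$, $J=[0,T]$, and let $F:J\times X\to X$ be such that $F(\cdot,x)$ is strongly measurable for every $x\in X$ and - (A1) for every $R>0$ there is $C_R>0$ such that, for almost every $t\in J$, $|F(t,x)|\le C_R$ for all $x$ with $|x|<R$; - (A2) for every $R>0$ there is $L_R>0$ such that, for almost every $t\in J$, $|F(t,x)-F(t,z)|\le L_R|x-z|$ for all $x,z$ with $|x|,|z|<R$. Then for every $f_0\in X$ and every $R>0$ there is $T'\in(0,T]$ such that the Cauchy problem $$\partial_t^\Phi f(t)=F(t,f(t))\ \text{ for a.e. } t\in[0,T'],\qquad f(0)=f_0,$$ has a unique solution $f$ in $C^\beta([0,T'],B_R(f_0))$, the set of $\beta$-Hölder continuous functions from $[0,T']$ to the open ball $B_R(f_0)=\{x\in X:|x-f_0|<R\}$. Here $$\partial_t^\Phi f(t)=\frac{d}{dt}\int_0^t\bar\nu_\Phi(t-s)\,(f(s)-f(0))\,ds ,$$ and a solution is understood to be an $f$ for which this is well defined: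 the Bochner integral exists for all $t\in[0,T']$, is an absolutely continuous function of $t$ on $[0,T']$, and is differentiable at almost every $t$. -/

import Mathlib

open Set MeasureTheory
open scoped NNReal ENNReal

noncomputable section

namespace GenCaputo

/-- `Φ : (0,∞) → ℝ` is a Bernstein function: smooth, nonnegative, and
`(-1)ⁿ Φ⁽ⁿ⁾ ≤ 0` for every `n ≥ 1`.  Only the values of `Φ` on `(0,∞)` matter. -/
structure IsBernstein (Φ : ℝ → ℝ) : Prop where
  contDiffOn : ContDiffOn ℝ (⊤ : ℕ∞) Φ (Ioi 0)
  nonneg : ∀ z : ℝ, 0 < z → 0 ≤ Φ z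
  alternating : ∀ n : ℕ, 1 ≤ n → ∀ z : ℝ, 0 < z → (-1 : ℝ) ^ n * iteratedDeriv n Φ z ≤ 0

/-- The conjugate `Φ⋆(z) = z / Φ(z)`. -/
def conjugate (Φ : ℝ → ℝ) : ℝ → ℝ := fun z => z / Φ z

/-- `Φ` is a special Bernstein function: it is a Bernstein function, and its conjugate is
(well defined and) a Bernstein function. -/
structure IsSpecialBernstein (Φ : ℝ → ℝ) : Prop where
  isBernstein : IsBernstein Φ
  ne_zero : ∀ z : ℝ, 0 < z → Φ z ≠ 0
  conjugate_isBernstein : IsBernstein (conjugate Φ)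

/-- `(a, b, ν)` is the Lévy triple of `Φ`: `a, b ≥ 0`, `ν` is a measure on `(0,∞)` with
`∫ (1 ∧ x) ν(dx) < ∞`, and `Φ(z) = a + b z + ∫ (1 - e^{-z x}) ν(dx)` for `z > 0`. -/
structure IsLevyTriple (Φ : ℝ → ℝ) (a b : ℝ) (ν : Measure ℝ) : Prop where
  nonneg_left : 0 ≤ a
  nonneg_right : 0 ≤ b
  measure_Iic : ν (Iic 0) = 0
  lintegral_lt_top : ∫⁻ x in Ioi 0, ENNReal.ofReal (min 1 x) ∂ν < ∞
  eq_integral : ∀ z : ℝ, 0 < z →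
    Φ z = a + b * z + ∫ x in Ioi 0, (1 - Real.exp (-(z * x))) ∂ν

/-- The tail `ν̄(t) = ν(t,∞)` of a Lévy measure. -/
def levyTail (ν : Measure ℝ) (t : ℝ) : ℝ := ν.real (Ioi t)

/-- `σ` is a subordinator, i.e. a non-decreasing Lévy process: it starts at `0`, has independent
and stationary increments and almost surely non-decreasing right-continuous paths (left limits
exist by monotonicity). -/
structure IsSubordinator {Ω : Type*} [MeasurableSpace Ω] (σ : ℝ≥0 → Ω → ℝ) (P : Measure Ω) :
    Prop where
  measurable : ∀ t, Measurable (σ t)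
  start_zero : ∀ᵐ ω ∂P, σ 0 ω = 0
  indep_increments : ProbabilityTheory.HasIndepIncrements σ P
  stationary_increments : ∀ s h : ℝ≥0,
    ProbabilityTheory.IdentDistrib (fun ω => σ (s + h) ω - σ s ω) (σ h) P P
  monotone_paths : ∀ᵐ ω ∂P, Monotone fun t => σ t ω
  rightCts_paths : ∀ᵐ ω ∂P, ∀ t : ℝ≥0, ContinuousWithinAt (fun s => σ s ω) (Ici t) t

/-- `Φ` is the Laplace exponent of `σ`: `E[e^{-z σ(t)}] = e^{-t Φ(z)}` for `t ≥ 0`, `z > 0`. -/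
def HasLaplaceExponent {Ω : Type*} [MeasurableSpace Ω] (σ : ℝ≥0 → Ω → ℝ) (P : Measure Ω)
    (Φ : ℝ → ℝ) : Prop :=
  ∀ (t : ℝ≥0) (z : ℝ), 0 < z →
    ∫ ω, Real.exp (-(z * σ t ω)) ∂P = Real.exp (-((t : ℝ) * Φ z))

/-- The potential measure `U(A) = E[∫₀^∞ 1_A(σ(s)) ds]`: the image of `ds ⊗ P` on
`[0,∞) × Ω` under `(s, ω) ↦ σ(s)(ω)`. -/
def potentialMeasure {Ω : Type*} [MeasurableSpace Ω] (σ : ℝ≥0 → Ω → ℝ) (P : Measure Ω) :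
    Measure ℝ :=
  (((volume : Measure ℝ).restrict (Ici 0)).prod P).map fun p => σ p.1.toNNReal p.2

/-- The potential density: the Lebesgue density of the potential measure (determined almost
everywhere; its non-increasing version, when there is one, satisfies an upper bound by a continuous
function at every point as soon as it does at almost every point). -/
def potentialDensity {Ω : Type*} [MeasurableSpace Ω] (σ : ℝ≥0 → Ω → ℝ) (P : Measure Ω) :
    ℝ → ℝ≥0∞ :=
  (potentialMeasure σ P).rnDeriv volume

/-- The standing assumption, with exponent `β`, on a special Bernstein function `Φ` with Lévy
measure `ν` and subordinator `σ`: the Lévy triple of `Φ` is `(0, 0, ν)`, `ν(0,∞) = ∞`, and the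
potential density is at most `C t^{β-1}` on some interval `(0, t₀)`. -/
structure StandingAssumption {Ω : Type*} [MeasurableSpace Ω] (Φ : ℝ → ℝ) (ν : Measure ℝ)
    (σ : ℝ≥0 → Ω → ℝ) (P : Measure Ω) (β : ℝ) : Prop where
  special : IsSpecialBernstein Φ
  levy : IsLevyTriple Φ 0 0 ν
  infinite : ν (Ioi 0) = ∞
  exponent_mem : β ∈ Ioo (0 : ℝ) 1
  density_le : ∃ t₀ > (0 : ℝ), ∃ C > (0 : ℝ), ∀ᵐ t ∂(volume.restrict (Ioo 0 t₀)),
    potentialDensity σ P t ≤ ENNReal.ofReal (C * t ^ (β - 1))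

variable {X : Type*} [NormedAddCommGroup X] [NormedSpace ℝ X]

/-- The convolution `t ↦ ∫₀ᵗ ν̄(t-s) (f(s) - f(0)) ds`, whose derivative is the generalized Caputo
derivative of `f`. -/
def caputoPrimitive (ν : Measure ℝ) (f : ℝ → X) (t : ℝ) : X :=
  ∫ s in (0 : ℝ)..t, levyTail ν (t - s) • (f s - f 0)

/-- On `[0, T]` the generalized Caputo derivative of `f` is well defined and equals `g` almost
everywhere: the convolution defining it is a Bochner integral for every `t`, it is absolutely
continuous on `[0, T]`, and it is differentiable with derivative `g t` at almost every `t`. -/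
structure HasGenCaputoDeriv (ν : Measure ℝ) (T : ℝ) (f g : ℝ → X) : Prop where
  integrable : ∀ t ∈ Icc 0 T,
    IntervalIntegrable (fun s => levyTail ν (t - s) • (f s - f 0)) volume 0 t
  absCts : AbsolutelyContinuousOnInterval (caputoPrimitive ν f) 0 T
  hasDerivAt : ∀ᵐ t ∂(volume.restrict (Icc 0 T)), HasDerivAt (caputoPrimitive ν f) (g t) t

/-- `f` solves `∂ₜ^Φ f(t) = F(t, f(t))` for a.e. `t ∈ [0, T]`, `f(0) = f₀`. -/
structure IsSolution (ν : Measure ℝ) (F : ℝ → X → X) (f₀ : X) (T : ℝ) (f : ℝ → X) : Prop where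
  initial : f 0 = f₀
  equation : HasGenCaputoDeriv ν T f fun t => F t (f t)

/-- `f` restricts to an element of `C^β([0, T], K)`. -/
def IsHolderInto (β T : ℝ) (K : Set X) (f : ℝ → X) : Prop :=
  MapsTo f (Icc 0 T) K ∧ ∃ L : ℝ≥0, HolderOnWith L β.toNNReal f (Icc 0 T)

end GenCaputo

end

/-!
# Local well-posedness of semilinear equations with a generalized Caputo derivative

Let `U` be the potential measure of the subordinator and `ν̄` the tail of its Lévy measure. Their
Laplace transforms are `1 / Φ(z)` and `Φ(z) / z`, so `U * ν̄ = 1` on `(0, ∞)` (`conv_tailMeasure`,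
through uniqueness of Laplace transforms, `ext_of_laplace`). Hence convolution with `U` inverts
`∂ₜ^Φ`, and the Cauchy problem is equivalent to the Volterra equation
`f(t) = f₀ + ∫ F(t - x, f(t - x)) U(dx)` (`isSolution_of_volterra`, `volterra_of_isSolution`). On a
short interval its right-hand side is a contraction of a closed ball of continuous functions, because
`U (0, h] → 0` as `h → 0`.

That `Φ` is special enters through monotonicity of `U`. Its conjugate `z ↦ z ∫ e^{-zx} U(dx)` is a
Bernstein function, and the sign of the `k`-th derivative of this function says precisely that the
Poisson averages `∫ e^{-zx} (zx)^k / k! U(dx)` decrease in `k` (`antitone_integral_poissonWeight`).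
These averages are the weights at `k / z` of a discrete approximation of `U`; in the language of test
functions, the approximation is the Szász–Mirakyan operator `szasz`, which tends to the identity as
`z → ∞`. In the limit, `U` decreases under shifts to the right (`measure_preimage_sub_le`). This is
the monotonicity of the potential density, in a form that presupposes no density, and it has two
consequences. A measure decreasing under shifts is absolutely continuous on `(0, ∞)`
(`absolutelyContinuous_of_shift`), and it has no atom at `0` because `Φ` is unbounded, so the bound on
the density bounds `U (0, h]` by a multiple of `h ^ β`. Moreover, `U * φ` is `β`-Hölder for bounded `φ`,
since the difference of `U` and its shift is a positive measure
(`IsCausal.norm_convolve_add_sub_le`).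
-/

namespace GenCaputo

open Filter Topology ProbabilityTheory

/-! ### Uniqueness of Laplace transforms -/

theorem integrable_exp_neg_mul {μ : Measure ℝ} {z : ℝ}
    (h : ∫⁻ x, ENNReal.ofReal (Real.exp (-(z * x))) ∂μ ≠ ∞) :
    Integrable (fun x => Real.exp (-(z * x))) μ := by
  refine ⟨by fun_prop, ?_⟩
  rw [hasFiniteIntegral_iff_ofReal (ae_of_all _ fun x => (Real.exp_pos _).le)]
  exact lt_top_iff_ne_top.2 h

theorem mem_interior_integrableExpSet {μ : Measure ℝ}
    (h : ∀ z : ℝ, 0 < z → ∫⁻ x, ENNReal.ofReal (Real.exp (-(z * x))) ∂μ ≠ ∞) {t : ℝ} (ht : t < 0) :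
    t ∈ interior (integrableExpSet id μ) := by
  refine mem_interior.2 ⟨Iio 0, fun s hs => ?_, isOpen_Iio, ht⟩
  have := integrable_exp_neg_mul (h (-s) (by simpa using hs))
  simpa [integrableExpSet] using this

theorem complexMGF_eqOn_of_laplace_eq {μ μ' : Measure ℝ}
    (hfin : ∀ z : ℝ, 0 < z → ∫⁻ x, ENNReal.ofReal (Real.exp (-(z * x))) ∂μ ≠ ∞)
    (h : ∀ z : ℝ, 0 < z → ∫⁻ x, ENNReal.ofReal (Real.exp (-(z * x))) ∂μ
      = ∫⁻ x, ENNReal.ofReal (Real.exp (-(z * x))) ∂μ') :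
    EqOn (complexMGF id μ) (complexMGF id μ') {z | z.re < 0} := by
  have hfin' : ∀ z : ℝ, 0 < z → ∫⁻ x, ENNReal.ofReal (Real.exp (-(z * x))) ∂μ' ≠ ∞ :=
    fun z hz => h z hz ▸ hfin z hz
  have hX : AnalyticOnNhd ℂ (complexMGF id μ) {z | z.re < 0} :=
    analyticOnNhd_complexMGF.mono fun z hz => mem_interior_integrableExpSet hfin hz
  have hY : AnalyticOnNhd ℂ (complexMGF id μ') {z | z.re < 0} :=
    analyticOnNhd_complexMGF.mono fun z hz => mem_interior_integrableExpSet hfin' hz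
  have hmgf : ∀ t : ℝ, t < 0 → mgf id μ t = mgf id μ' t := by
    intro t ht
    have h1 := h (-t) (by linarith)
    simp only [mgf, id]
    rw [integral_eq_lintegral_of_nonneg_ae (ae_of_all _ fun x => (Real.exp_pos _).le) (by fun_prop),
      integral_eq_lintegral_of_nonneg_ae (ae_of_all _ fun x => (Real.exp_pos _).le) (by fun_prop)]
    simp only [neg_mul, neg_neg] at h1
    rw [h1]
  refine hX.eqOn_of_preconnected_of_frequently_eq hY
    (convex_halfSpace_re_lt 0).isPreconnected (z₀ := ((-1 : ℝ) : ℂ)) (by simp) ?_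
  have h_real : ∃ᶠ x : ℝ in 𝓝[≠] (-1), complexMGF id μ x = complexMGF id μ' x := by
    refine Eventually.frequently (eventually_nhdsWithin_of_eventually_nhds ?_)
    filter_upwards [Iio_mem_nhds (show (-1 : ℝ) < 0 by norm_num)] with x hx
    rw [complexMGF_ofReal, complexMGF_ofReal, hmgf x hx]
  rw [frequently_iff_seq_forall] at h_real ⊢
  obtain ⟨xs, hx_tendsto, hx_eq⟩ := h_real
  refine ⟨fun n ↦ xs n, ?_, fun n ↦ ?_⟩
  · rw [tendsto_nhdsWithin_iff] at hx_tendsto ⊢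
    constructor
    · exact (Complex.continuous_ofReal.tendsto _).comp hx_tendsto.1
    · filter_upwards [hx_tendsto.2] with n hn
      simpa only [mem_compl_iff, mem_singleton_iff, Complex.ofReal_inj] using hn
  · simp [hx_eq]

theorem withDensity_exp_withDensity_exp (μ : Measure ℝ) :
    (μ.withDensity fun x => ENNReal.ofReal (Real.exp (-x))).withDensity
      (fun x => ENNReal.ofReal (Real.exp x)) = μ := by
  rw [← withDensity_mul _ (by fun_prop) (by fun_prop)]
  have : ((fun x => ENNReal.ofReal (Real.exp (-x))) * fun x => ENNReal.ofReal (Real.exp x))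
      = fun _ : ℝ => (1 : ℝ≥0∞) := by
    ext x
    simp only [Pi.mul_apply]
    rw [← ENNReal.ofReal_mul (Real.exp_pos _).le, ← Real.exp_add]
    simp
  rw [this]
  simp

/-- A measure on the line is determined by its Laplace transform, if that is finite on `(0, ∞)`:
the transforms extend holomorphically to a half plane, hence agree on the line `re = -1`, and this
identifies the characteristic functions of the finite measures `e^{-x} μ(dx)`. -/
theorem ext_of_laplace {μ μ' : Measure ℝ}
    (hfin : ∀ z : ℝ, 0 < z → ∫⁻ x, ENNReal.ofReal (Real.exp (-(z * x))) ∂μ ≠ ∞)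
    (h : ∀ z : ℝ, 0 < z → ∫⁻ x, ENNReal.ofReal (Real.exp (-(z * x))) ∂μ
      = ∫⁻ x, ENNReal.ofReal (Real.exp (-(z * x))) ∂μ') :
    μ = μ' := by
  rw [← withDensity_exp_withDensity_exp μ, ← withDensity_exp_withDensity_exp μ']
  have f1 : IsFiniteMeasure (μ.withDensity fun x => ENNReal.ofReal (Real.exp (-x))) :=
    isFiniteMeasure_withDensity (by simpa using hfin 1 one_pos)
  have f2 : IsFiniteMeasure (μ'.withDensity fun x => ENNReal.ofReal (Real.exp (-x))) :=
    isFiniteMeasure_withDensity (by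
      have := hfin 1 one_pos
      rw [h 1 one_pos] at this
      simpa using this)
  congr 1
  have key : ∀ (ρ : Measure ℝ) (t : ℝ),
      charFun (ρ.withDensity fun x => ENNReal.ofReal (Real.exp (-x))) t
        = complexMGF id ρ (-1 + t * Complex.I) := by
    intro ρ t
    rw [charFun_apply_real, complexMGF,
      integral_withDensity_eq_integral_toReal_smul (by fun_prop) (by simp)]
    refine integral_congr_ae (ae_of_all _ fun x => ?_)
    simp only [ENNReal.toReal_ofReal (Real.exp_pos _).le, id, Complex.real_smul,
      Complex.ofReal_exp, ← Complex.exp_add]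
    congr 1
    push_cast
    ring
  refine Measure.ext_of_charFun (funext fun t => ?_)
  rw [key, key]
  exact complexMGF_eqOn_of_laplace_eq hfin h (by simp)

/-! ### The Szász–Mirakyan operators -/

/-- The probability that a Poisson variable of mean `l` is `k`. -/
noncomputable def poissonWeight (l : ℝ) (k : ℕ) : ℝ := Real.exp (-l) * l ^ k / k.factorial

theorem poissonWeight_nonneg {l : ℝ} (hl : 0 ≤ l) (k : ℕ) : 0 ≤ poissonWeight l k := by
  unfold poissonWeight; positivity

theorem hasSum_poissonWeight_mul_pow (l r : ℝ) :
    HasSum (fun k => poissonWeight l k * r ^ k) (Real.exp (l * r - l)) := by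
  have h := (NormedSpace.expSeries_div_hasSum_exp (l * r)).mul_left (Real.exp (-l))
  rw [← Real.exp_eq_exp_ℝ, ← Real.exp_add, show -l + l * r = l * r - l by ring] at h
  refine h.congr_fun fun k => ?_
  simp only [poissonWeight, mul_pow]; ring

theorem hasSum_poissonWeight (l : ℝ) : HasSum (poissonWeight l) 1 := by
  simpa using hasSum_poissonWeight_mul_pow l 1

theorem hasSum_poissonWeight_mul (l : ℝ) : HasSum (fun k => poissonWeight l k * k) l := by
  rw [← hasSum_nat_add_iff' 1]
  have h := (hasSum_poissonWeight l).mul_left l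
  simp only [Finset.range_one, Finset.sum_singleton, Nat.cast_zero, mul_zero, sub_zero]
  rw [mul_one] at h
  refine h.congr_fun fun k => ?_
  simp only [poissonWeight, Nat.factorial_succ, pow_succ]
  push_cast
  field_simp

theorem hasSum_poissonWeight_mul_sq (l : ℝ) :
    HasSum (fun k => poissonWeight l k * (k : ℝ) ^ 2) (l ^ 2 + l) := by
  rw [← hasSum_nat_add_iff' 1]
  have h := ((hasSum_poissonWeight_mul l).add (hasSum_poissonWeight l)).mul_left l
  simp only [Finset.range_one, Finset.sum_singleton, Nat.cast_zero, ne_eq, OfNat.ofNat_ne_zero,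
    not_false_eq_true, zero_pow, mul_zero, sub_zero]
  rw [show l * (l + 1) = l ^ 2 + l by ring] at h
  refine h.congr_fun fun k => ?_
  simp only [poissonWeight, Nat.factorial_succ, pow_succ]
  push_cast
  field_simp

/-- The Szász–Mirakyan operator: the expectation of `g (N / z)` for a Poisson variable `N` of mean
`z x`. -/
noncomputable def szasz (g : ℝ → ℝ) (z x : ℝ) : ℝ := ∑' k : ℕ, g (k / z) * poissonWeight (z * x) k

theorem szasz_summable {g : ℝ → ℝ} (h0 : ∀ x, 0 ≤ g x) (h1 : ∀ x, g x ≤ 1) {z x : ℝ}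
    (hz : 0 < z) (hx : 0 ≤ x) : Summable fun k : ℕ => g (k / z) * poissonWeight (z * x) k := by
  have hw := poissonWeight_nonneg (mul_nonneg hz.le hx)
  refine Summable.of_nonneg_of_le (fun k => mul_nonneg (h0 _) (hw k)) (fun k => ?_)
    (hasSum_poissonWeight (z * x)).summable
  exact mul_le_of_le_one_left (hw k) (h1 _)

/-- Chebyshev's bound, from the variance `z x` of the Poisson law. -/
theorem abs_szasz_sub_le {g : ℝ → ℝ} {L : ℝ≥0} (hg : LipschitzWith L g) (h0 : ∀ x, 0 ≤ g x)
    (h1 : ∀ x, g x ≤ 1) {z x : ℝ} (hz : 0 < z) (hx : 0 ≤ x) :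
    |szasz g z x - g x| ≤ L * (1 + x) / √z := by
  have hw := poissonWeight_nonneg (mul_nonneg hz.le hx)
  have hs : 0 < √z := Real.sqrt_pos.2 hz
  have hss : √z * √z = z := Real.mul_self_sqrt hz.le
  have e1 : HasSum (fun k : ℕ => (g (k / z) - g x) * poissonWeight (z * x) k)
      (szasz g z x - g x) := by
    have := (szasz_summable h0 h1 hz hx).hasSum.sub ((hasSum_poissonWeight (z * x)).mul_left (g x))
    rw [mul_one] at this
    refine this.congr_fun fun k => ?_
    ring
  have e2 : HasSum (fun k : ℕ => L * ((1 / √z + √z * (k / z - x) ^ 2) * poissonWeight (z * x) k))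
      (L * ((1 + x) / √z)) := by
    have h2 := (((hasSum_poissonWeight_mul_sq (z * x)).sub
      ((hasSum_poissonWeight_mul (z * x)).mul_left (2 * (z * x)))).add
      ((hasSum_poissonWeight (z * x)).mul_left ((z * x) ^ 2))).mul_left (√z / z ^ 2)
    have h3 := (((hasSum_poissonWeight (z * x)).mul_left (1 / √z)).add h2).mul_left (L : ℝ)
    have h4 : 1 / √z * 1 +
        √z / z ^ 2 * ((z * x) ^ 2 + z * x - 2 * (z * x) * (z * x) + (z * x) ^ 2 * 1)
          = (1 + x) / √z := by
      have h5 : √z / z ^ 2 * ((z * x) ^ 2 + z * x - 2 * (z * x) * (z * x) + (z * x) ^ 2 * 1)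
          = x * (√z / z) := by
        field_simp
        ring
      rw [h5, Real.sqrt_div_self]
      ring
    rw [h4] at h3
    refine h3.congr_fun fun k => ?_
    congr 1
    field_simp
    ring
  rw [mul_div_assoc]
  refine (le_of_eq (Real.norm_eq_abs _).symm).trans ?_
  refine e1.norm_le_of_bounded e2 fun k => ?_
  rw [norm_mul, Real.norm_of_nonneg (hw k), ← mul_assoc]
  refine mul_le_mul_of_nonneg_right ?_ (hw k)
  refine (hg.dist_le_mul (k / z) x |>.trans_eq' (Real.dist_eq _ _).symm).trans ?_
  refine mul_le_mul_of_nonneg_left ?_ L.2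
  rw [Real.dist_eq]
  -- `|y| ≤ ε + y² / ε` for `ε = 1 / √z`
  set y := (k : ℝ) / z - x
  rw [div_add' _ _ _ hs.ne', le_div_iff₀ hs]
  nlinarith [sq_nonneg (√z * |y| - 1), sq_abs y, abs_nonneg y]

theorem szasz_nonneg {g : ℝ → ℝ} (h0 : ∀ x, 0 ≤ g x) {z x : ℝ}
    (hz : 0 < z) (hx : 0 ≤ x) : 0 ≤ szasz g z x :=
  tsum_nonneg fun k => mul_nonneg (h0 _) (poissonWeight_nonneg (mul_nonneg hz.le hx) k)

/-- A domination that is uniform in `z`, from the exponential moments of the Poisson law. -/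
theorem szasz_le {g : ℝ → ℝ} {b : ℝ} (h0 : ∀ x, 0 ≤ g x) (h1 : ∀ x, g x ≤ 1)
    (hb : ∀ x, b < x → g x = 0) {z x : ℝ} (hz : 1 ≤ z) (hx : 0 ≤ x) :
    szasz g z x ≤ Real.exp b * Real.exp (-(2⁻¹ * x)) := by
  have hz0 : 0 < z := by linarith
  have hw := poissonWeight_nonneg (mul_nonneg hz0.le hx)
  have h2 := (hasSum_poissonWeight_mul_pow (z * x) (Real.exp (-(1 / z)))).mul_left (Real.exp b)
  refine (hasSum_le (fun k => ?_) (szasz_summable h0 h1 hz0 hx).hasSum h2).trans ?_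
  · rw [mul_comm (poissonWeight _ _), ← mul_assoc]
    refine mul_le_mul_of_nonneg_right ?_ (hw k)
    rw [← Real.exp_nat_mul, ← Real.exp_add]
    rcases lt_or_ge b (k / z) with h | h
    · rw [hb _ h]; exact (Real.exp_pos _).le
    · refine (h1 _).trans (Real.one_le_exp ?_)
      have : (k : ℝ) * -(1 / z) = - (k / z) := by ring
      linarith
  · refine mul_le_mul_of_nonneg_left (Real.exp_le_exp.2 ?_) (Real.exp_pos _).le
    -- `e^{-1/z} ≤ z / (z + 1)`, since `1 + 1 / z ≤ e^{1/z}`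
    have h3 : Real.exp (-(1 / z)) * (1 + 1 / z) ≤ 1 := by
      rw [Real.exp_neg]
      have := Real.add_one_le_exp (1 / z)
      rw [inv_mul_le_iff₀ (Real.exp_pos _)]
      linarith
    have h4 : Real.exp (-(1 / z)) * (z + 1) ≤ z := by
      have h5 := mul_le_mul_of_nonneg_right h3 hz0.le
      have h6 : Real.exp (-(1 / z)) * (1 + 1 / z) * z = Real.exp (-(1 / z)) * (z + 1) := by
        field_simp
      linarith
    have h7 : 2⁻¹ ≤ z * (1 - Real.exp (-(1 / z))) := by
      have hpos := Real.exp_pos (-(1 / z))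
      nlinarith
    nlinarith

/-! ### Measures that decrease under shifts -/

section Shift

variable {U : Measure ℝ}

theorem measure_Iic_lt_top
    (hfin : ∀ z : ℝ, 0 < z → ∫⁻ x, ENNReal.ofReal (Real.exp (-(z * x))) ∂U ≠ ∞) (b : ℝ) :
    U (Iic b) < ∞ := by
  have h := mul_meas_ge_le_lintegral₀ (μ := U) (f := fun x => ENNReal.ofReal (Real.exp (-(1 * x))))
    (by fun_prop) (ENNReal.ofReal (Real.exp (-b)))
  have hsub : Iic b ⊆ {x | ENNReal.ofReal (Real.exp (-b)) ≤ ENNReal.ofReal (Real.exp (-(1 * x)))} :=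
    fun x hx => ENNReal.ofReal_le_ofReal (Real.exp_le_exp.2 (by simpa using hx))
  refine lt_of_le_of_lt (measure_mono hsub) ?_
  refine ENNReal.lt_top_of_mul_ne_top_right (h.trans_lt (lt_top_iff_ne_top.2 (hfin 1 one_pos))).ne ?_
  simp [Real.exp_pos]

theorem continuous_poissonWeight (k : ℕ) : Continuous fun l => poissonWeight l k := by
  unfold poissonWeight; fun_prop

theorem integrable_poissonWeight
    (hfin : ∀ z : ℝ, 0 < z → ∫⁻ x, ENNReal.ofReal (Real.exp (-(z * x))) ∂U ≠ ∞) {z : ℝ}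
    (hz : 0 < z) (k : ℕ) : Integrable (fun x => poissonWeight (z * x) k) U := by
  have h := (integrable_pow_mul_exp_of_mem_interior_integrableExpSet
    (mem_interior_integrableExpSet hfin (neg_lt_zero.2 hz)) k).const_mul (z ^ k / k.factorial)
  refine h.congr (ae_of_all _ fun x => ?_)
  simp only [poissonWeight, id, mul_pow, neg_mul]
  ring

theorem szasz_eq_sum {g : ℝ → ℝ} {z : ℝ} {K : ℕ} (hK : ∀ k : ℕ, K ≤ k → g (k / z) = 0) (x : ℝ) :
    szasz g z x = ∑ k ∈ Finset.range K, g (k / z) * poissonWeight (z * x) k :=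
  tsum_eq_sum fun k hk => by rw [hK k (by simpa using hk), zero_mul]

/-- Integrating `szasz g z` against `U` tests `g` against the discretization of `U` with weights
`∫ e^{-zx} (zx)^k / k! U(dx)` at the points `k / z`. -/
theorem integral_szasz
    (hfin : ∀ z : ℝ, 0 < z → ∫⁻ x, ENNReal.ofReal (Real.exp (-(z * x))) ∂U ≠ ∞) {g : ℝ → ℝ} {z : ℝ}
    (hz : 0 < z) {K : ℕ} (hK : ∀ k : ℕ, K ≤ k → g (k / z) = 0) :
    ∫ x, szasz g z x ∂U = ∑ k ∈ Finset.range K, g (k / z) * ∫ x, poissonWeight (z * x) k ∂U := by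
  simp_rw [szasz_eq_sum hK]
  rw [integral_finsetSum _ fun k _ => (integrable_poissonWeight hfin hz k).const_mul _]
  simp_rw [integral_const_mul]

/-- For `z = m / h` the shift by `h` moves the nodes `k / z` by `m` places, so that the
monotonicity of the weights compares the two sums term by term. -/
theorem integral_szasz_comp_sub_le
    (hfin : ∀ z : ℝ, 0 < z → ∫⁻ x, ENNReal.ofReal (Real.exp (-(z * x))) ∂U ≠ ∞)
    (hq : ∀ z : ℝ, 0 < z → Antitone fun k : ℕ => ∫ x, poissonWeight (z * x) k ∂U)
    {g : ℝ → ℝ} {b h : ℝ} (hh : 0 < h) (h0 : ∀ x, 0 ≤ g x) (hneg : ∀ x, x ≤ 0 → g x = 0)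
    (hb : ∀ x, b < x → g x = 0) {m : ℕ} (hm : 0 < m) :
    ∫ x, szasz (fun y => g (y - h)) (m / h) x ∂U ≤ ∫ x, szasz g (m / h) x ∂U := by
  have hm' : (0 : ℝ) < m := Nat.cast_pos.2 hm
  have hz : 0 < (m : ℝ) / h := by positivity
  set z := (m : ℝ) / h with hzdef
  have hshift : ∀ k : ℕ, ((m + k : ℕ) : ℝ) / z - h = k / z := by
    intro k
    rw [hzdef]
    push_cast
    field_simp
    ring
  set K := ⌊b * z⌋₊ + 1
  have hK : ∀ k : ℕ, K ≤ k → g (k / z) = 0 := by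
    intro k hk
    refine hb _ ?_
    rw [lt_div_iff₀ hz]
    refine (Nat.lt_floor_add_one _).trans_le ?_
    exact_mod_cast hk
  have hK' : ∀ k : ℕ, m + K ≤ k → (fun y => g (y - h)) (k / z) = 0 := by
    intro k hk
    obtain ⟨j, rfl⟩ := Nat.exists_eq_add_of_le (le_of_add_le_left hk)
    simp only [hshift]
    exact hK j (by omega)
  rw [integral_szasz hfin hz hK', integral_szasz hfin hz hK, Finset.sum_range_add]
  simp only [hshift]
  rw [Finset.sum_eq_zero, zero_add]
  · exact Finset.sum_le_sum fun k _ =>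
      mul_le_mul_of_nonneg_left (hq z hz (Nat.le_add_left k m)) (h0 _)
  · intro k hk
    rw [hneg _ _, zero_mul]
    rw [hzdef, sub_nonpos, div_le_iff₀ hz, hzdef, mul_div_cancel₀ _ hh.ne']
    exact_mod_cast (Finset.mem_range.1 hk).le

/-- The discretizations of `U` converge to `U`, tested against Lipschitz functions supported in
`(-∞, b]`. -/
theorem tendsto_integral_szasz (hsupp : U (Iio 0) = 0)
    (hfin : ∀ z : ℝ, 0 < z → ∫⁻ x, ENNReal.ofReal (Real.exp (-(z * x))) ∂U ≠ ∞)
    {g : ℝ → ℝ} {b : ℝ} {L : ℝ≥0} (hg : LipschitzWith L g) (h0 : ∀ x, 0 ≤ g x)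
    (h1 : ∀ x, g x ≤ 1) (hb : ∀ x, b < x → g x = 0) :
    Tendsto (fun z => ∫ x, szasz g z x ∂U) atTop (𝓝 (∫ x, g x ∂U)) := by
  have hae : ∀ᵐ x ∂U, 0 ≤ x := by
    rw [ae_iff]
    simpa [Iio] using hsupp
  refine tendsto_integral_filter_of_dominated_convergence
    (fun x => Real.exp b * Real.exp (-(2⁻¹ * x))) ?_ ?_ ?_ ?_
  · filter_upwards [eventually_gt_atTop 0] with z hz
    have hK : ∀ k : ℕ, ⌊b * z⌋₊ + 1 ≤ k → g (k / z) = 0 := by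
      intro k hk
      refine hb _ ?_
      rw [lt_div_iff₀ hz]
      exact (Nat.lt_floor_add_one _).trans_le (by exact_mod_cast hk)
    rw [funext (szasz_eq_sum hK)]
    have := continuous_poissonWeight
    fun_prop
  · filter_upwards [eventually_ge_atTop 1] with z hz
    filter_upwards [hae] with x hx
    rw [Real.norm_of_nonneg (szasz_nonneg h0 (by linarith) hx)]
    exact szasz_le h0 h1 hb hz hx
  · exact (integrable_exp_neg_mul (hfin _ (by norm_num))).const_mul _
  · filter_upwards [hae] with x hx
    rw [tendsto_iff_dist_tendsto_zero]
    have : Tendsto (fun z : ℝ => L * (1 + x) / √z) atTop (𝓝 0) :=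
      tendsto_const_nhds.div_atTop Real.tendsto_sqrt_atTop
    refine squeeze_zero' (Eventually.of_forall fun _ => dist_nonneg) ?_ this
    filter_upwards [eventually_gt_atTop 0] with z hz
    rw [Real.dist_eq]
    exact abs_szasz_sub_le hg h0 h1 hz hx

theorem integral_comp_sub_le (hsupp : U (Iio 0) = 0)
    (hfin : ∀ z : ℝ, 0 < z → ∫⁻ x, ENNReal.ofReal (Real.exp (-(z * x))) ∂U ≠ ∞)
    (hq : ∀ z : ℝ, 0 < z → Antitone fun k : ℕ => ∫ x, poissonWeight (z * x) k ∂U)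
    {g : ℝ → ℝ} {b h : ℝ} {L : ℝ≥0} (hh : 0 < h) (hg : LipschitzWith L g) (h0 : ∀ x, 0 ≤ g x)
    (h1 : ∀ x, g x ≤ 1) (hneg : ∀ x, x ≤ 0 → g x = 0) (hb : ∀ x, b < x → g x = 0) :
    ∫ x, g (x - h) ∂U ≤ ∫ x, g x ∂U := by
  have hg' : LipschitzWith L fun y => g (y - h) := by
    have := hg.comp (LipschitzWith.id.sub (LipschitzWith.const h) : LipschitzWith (1 + 0) _)
    rw [add_zero, mul_one] at this
    exact this
  have hlim : Tendsto (fun m : ℕ => (m : ℝ) / h) atTop atTop :=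
    tendsto_natCast_atTop_atTop.atTop_div_const hh
  refine le_of_tendsto_of_tendsto
    ((tendsto_integral_szasz (b := b + h) hsupp hfin hg' (fun x => h0 _) (fun x => h1 _)
      fun x hx => hb _ (by linarith)).comp hlim)
    ((tendsto_integral_szasz hsupp hfin hg h0 h1 hb).comp hlim) ?_
  filter_upwards [eventually_gt_atTop 0] with m hm
  exact integral_szasz_comp_sub_le hfin hq hh h0 hneg hb hm

theorem measure_preimage_sub_le_of_isCompact (hsupp : U (Iio 0) = 0)
    (hfin : ∀ z : ℝ, 0 < z → ∫⁻ x, ENNReal.ofReal (Real.exp (-(z * x))) ∂U ≠ ∞)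
    (hq : ∀ z : ℝ, 0 < z → Antitone fun k : ℕ => ∫ x, poissonWeight (z * x) k ∂U)
    {h : ℝ} (hh : 0 < h) {K : Set ℝ} (hK : IsCompact K) (hK0 : K ⊆ Ioi 0) :
    U ((fun x => x - h) ⁻¹' K) ≤ U K := by
  rcases K.eq_empty_or_nonempty with rfl | hne
  · simp
  obtain ⟨a, haK, ha⟩ := hK.exists_isLeast hne
  have ha0 : 0 < a := hK0 haK
  obtain ⟨c, hcK, hc⟩ := hK.exists_isGreatest hne
  have hδ : ∀ n : ℕ, 0 < a * (1 / ((n : ℝ) + 1)) := fun n => by positivity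
  have hδa : ∀ n : ℕ, a * (1 / ((n : ℝ) + 1)) ≤ a := fun n => by
    refine mul_le_of_le_one_right ha0.le ?_
    rw [div_le_one (by positivity)]
    have : (0 : ℝ) ≤ n := n.cast_nonneg
    linarith
  have hlim : Tendsto (fun n : ℕ => a * (1 / ((n : ℝ) + 1))) atTop (𝓝 0) := by
    simpa using (tendsto_one_div_add_atTop_nhds_zero_nat (𝕜 := ℝ)).const_mul a
  set g : ℕ → ℝ → ℝ≥0 := fun n => thickenedIndicator (hδ n) K
  have hle : ∀ n x, (g n x : ℝ) ≤ 1 := fun n x =>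
    NNReal.coe_le_one.2 (thickenedIndicator_le_one (hδ n) K x)
  have hzero : ∀ n x, g n x ≠ 0 → 0 < x ∧ x ≤ c + a := by
    intro n x hx
    have hmem : x ∈ Metric.thickening (a * (1 / ((n : ℝ) + 1))) K := by
      by_contra hcon
      exact hx (thickenedIndicator_zero (hδ n) K hcon)
    obtain ⟨y, hy, hxy⟩ := Metric.mem_thickening_iff.1 hmem
    rw [Real.dist_eq, abs_lt] at hxy
    have h1 := ha hy
    have h2 := hc hy
    have h3 := hδa n
    constructor <;> linarith [hxy.1, hxy.2]
  set μ := U.restrict (Iic (c + a)) with hμ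
  have hfinμ : IsFiniteMeasure μ := ⟨by simpa [hμ] using measure_Iic_lt_top hfin (c + a)⟩
  have hl := tendsto_lintegral_thickenedIndicator_of_isClosed μ hK.isClosed hδ hlim
  have hμK : μ K ≤ U K := Measure.restrict_apply_le _ _
  refine le_trans (ge_of_tendsto' hl fun n => ?_) hμK
  have hgm : Continuous (g n) := (thickenedIndicator (hδ n) K).continuous
  have hrestr : ∫⁻ x, g n x ∂μ = ∫⁻ x, g n x ∂U := by
    rw [hμ]
    refine setLIntegral_eq_of_support_subset ?_
    intro x hx
    exact (hzero n x (by simpa using hx)).2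
  have hLip : LipschitzWith (a * (1 / ((n : ℝ) + 1))).toNNReal⁻¹ fun x => (g n x : ℝ) :=
    lipschitzWith_thickenedIndicator (hδ n) K
  have hint := integral_comp_sub_le (b := c + a) hsupp hfin hq hh hLip (fun x => (g n x).2)
    (hle n)
    (fun x hx => by
      by_contra hcon
      exact absurd (hzero n x (by simpa using hcon)).1 (not_lt.2 hx))
    (fun x hx => by
      by_contra hcon
      exact absurd (hzero n x (by simpa using hcon)).2 (not_le.2 hx))
  have hint2 : Integrable (fun x => (g n x : ℝ)) U := by
    refine Integrable.mono' ((integrable_exp_neg_mul (hfin 1 one_pos)).const_mul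
      (Real.exp (c + a))) (by fun_prop) (ae_of_all _ fun x => ?_)
    rw [← Real.exp_add]
    by_cases hx : g n x = 0
    · simp [hx, (Real.exp_pos _).le]
    · rw [NNReal.norm_eq]
      refine le_trans (b := 1) (hle n x) ?_
      exact Real.one_le_exp (by linarith [(hzero n x hx).2])
  have hint3 : Integrable (fun x => (g n (x - h) : ℝ)) U := by
    refine Integrable.mono' ((integrable_exp_neg_mul (hfin 1 one_pos)).const_mul
      (Real.exp (c + a + h))) (by fun_prop) (ae_of_all _ fun x => ?_)
    rw [← Real.exp_add]
    by_cases hx : g n (x - h) = 0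
    · simp [hx, (Real.exp_pos _).le]
    · rw [NNReal.norm_eq]
      refine le_trans (b := 1) (hle n _) ?_
      exact Real.one_le_exp (by linarith [(hzero n _ hx).2])
  calc U ((fun x => x - h) ⁻¹' K)
      = ∫⁻ x, ((fun x => x - h) ⁻¹' K).indicator 1 x ∂U := by
        rw [lintegral_indicator_one (hK.measurableSet.preimage (by fun_prop))]
    _ ≤ ∫⁻ x, g n (x - h) ∂U := by
        refine lintegral_mono fun x => ?_
        by_cases hx : x - h ∈ K
        · have : g n (x - h) = 1 := thickenedIndicator_one (hδ n) K hx
          simp [hx, this]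
        · simp [hx]
    _ = ENNReal.ofReal (∫ x, (g n (x - h) : ℝ) ∂U) := by
        rw [ofReal_integral_eq_lintegral_ofReal hint3 (ae_of_all _ fun x => (g n (x - h)).2)]
        simp
    _ ≤ ENNReal.ofReal (∫ x, (g n x : ℝ) ∂U) := ENNReal.ofReal_le_ofReal hint
    _ = ∫⁻ x, g n x ∂U := by
        rw [ofReal_integral_eq_lintegral_ofReal hint2 (ae_of_all _ fun x => (g n x).2)]
        simp
    _ = ∫⁻ x, g n x ∂μ := hrestr.symm

/-- Monotonicity of the Poisson averages `k ↦ ∫ e^{-zx} (zx)^k / k! U(dx)` for every `z` means that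
`U` decreases under shifts to the right. -/
theorem measure_preimage_sub_le (hsupp : U (Iio 0) = 0)
    (hfin : ∀ z : ℝ, 0 < z → ∫⁻ x, ENNReal.ofReal (Real.exp (-(z * x))) ∂U ≠ ∞)
    (hq : ∀ z : ℝ, 0 < z → Antitone fun k : ℕ => ∫ x, poissonWeight (z * x) k ∂U)
    {h : ℝ} (hh : 0 < h) {A : Set ℝ} (hA : MeasurableSet A) (hA0 : A ⊆ Ioi 0) :
    U ((fun x => x - h) ⁻¹' A) ≤ U A := by
  have hmeas : Measurable fun x : ℝ => x - h := by fun_prop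
  have hloc : IsLocallyFiniteMeasure (U.map fun x => x - h) := by
    refine ⟨fun x => ⟨Iic (x + 1), Iic_mem_nhds (lt_add_one x), ?_⟩⟩
    rw [Measure.map_apply hmeas measurableSet_Iic]
    refine (measure_mono (fun y hy => ?_)).trans_lt (measure_Iic_lt_top hfin (x + 1 + h))
    simp only [mem_preimage, mem_Iic] at hy ⊢
    linarith
  rw [← Measure.map_apply hmeas hA, hA.measure_eq_iSup_isCompact]
  refine iSup₂_le fun K hKA => iSup_le fun hK => ?_
  rw [Measure.map_apply hmeas hK.measurableSet]
  exact (measure_preimage_sub_le_of_isCompact hsupp hfin hq hh hK (hKA.trans hA0)).trans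
    (measure_mono hKA)

/-- A measure that decreases under shifts has a Lebesgue density on `(0, ∞)`: averaging
`U A ≤ U (A - s)` over `s` bounds `U A` by an integral of Lebesgue measures of translates of `A`. -/
theorem absolutelyContinuous_of_shift (hfin : ∀ b, U (Iic b) < ∞)
    (h0 : U (Iic 0) = 0) (hshift : ∀ h : ℝ, 0 < h → ∀ A : Set ℝ, MeasurableSet A → A ⊆ Ioi 0 →
      U ((fun x => x - h) ⁻¹' A) ≤ U A) : U ≪ volume := by
  have hloc : IsLocallyFiniteMeasure U :=
    ⟨fun x => ⟨Iic (x + 1), Iic_mem_nhds (lt_add_one x), hfin _⟩⟩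
  refine Measure.AbsolutelyContinuous.mk fun A hA hA0 => ?_
  have key : ∀ a : ℝ, 0 < a → U (A ∩ Ioi a) = 0 := by
    intro a ha
    set B := A ∩ Ioi a
    have hB : MeasurableSet B := hA.inter measurableSet_Ioi
    have hBv : volume B = 0 := measure_mono_null inter_subset_left hA0
    have h1 : ∀ s ∈ Ioo 0 a, U B ≤ U ((fun x => x + s) ⁻¹' B) := by
      intro s hs
      have := hshift s hs.1 ((fun x => x + s) ⁻¹' B) (hB.preimage (by fun_prop)) (fun x hx => by
        have : a < x + s := hx.2
        have := hs.2
        simp only [mem_Ioi]; linarith)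
      simpa [← preimage_comp, Function.comp_def] using this
    have h2 : ∫⁻ s in Ioo 0 a, U ((fun x => x + s) ⁻¹' B) = 0 := by
      have hBp : MeasurableSet {p : ℝ × ℝ | p.2 + p.1 ∈ B} := hB.preimage (by fun_prop)
      have e1 := Measure.prod_apply (μ := volume.restrict (Ioo 0 a)) (ν := U) hBp
      have e2 := Measure.prod_apply_symm (μ := volume.restrict (Ioo 0 a)) (ν := U) hBp
      have e3 : ∫⁻ s in Ioo 0 a, U ((fun x => x + s) ⁻¹' B)
          = ∫⁻ y, volume.restrict (Ioo 0 a) ((fun s => (s, y)) ⁻¹' {p : ℝ × ℝ | p.2 + p.1 ∈ B}) ∂U := by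
        rw [← e2, e1]; rfl
      rw [e3]
      refine lintegral_eq_zero_of_ae_eq_zero (ae_of_all _ fun y => ?_)
      refine le_antisymm ((Measure.restrict_apply_le _ _).trans ?_) bot_le
      have : ((fun s => (s, y)) ⁻¹' {p : ℝ × ℝ | p.2 + p.1 ∈ B}) = (fun s => y + s) ⁻¹' B := rfl
      rw [this, measure_preimage_add, hBv]
      exact le_rfl
    have h3 : U B * ENNReal.ofReal a ≤ 0 := by
      rw [← h2]
      calc U B * ENNReal.ofReal a = ∫⁻ s in Ioo 0 a, U B := by
            rw [setLIntegral_const, Real.volume_Ioo, sub_zero]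
        _ ≤ _ := setLIntegral_mono' measurableSet_Ioo h1
    have h4 := nonpos_iff_eq_zero.1 h3
    rcases mul_eq_zero.1 h4 with h | h
    · exact h
    · exact absurd (ENNReal.ofReal_eq_zero.1 h) (not_le.2 ha)
  have hsub : A ⊆ Iic 0 ∪ ⋃ n : ℕ, A ∩ Ioi (1 / ((n : ℝ) + 1)) := by
    intro x hx
    rcases le_or_gt x 0 with h | h
    · exact Or.inl h
    · obtain ⟨n, hn⟩ := exists_nat_one_div_lt h
      exact Or.inr (mem_iUnion.2 ⟨n, hx, hn⟩)
  refine measure_mono_null hsub (measure_union_null h0 ?_)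
  exact measure_iUnion_null fun n => key _ (by positivity)

end Shift

/-! ### The potential measure -/

section Potential

variable {Ω : Type*} [MeasurableSpace Ω] {P : Measure Ω} {σ : ℝ≥0 → Ω → ℝ} {Φ : ℝ → ℝ}

theorem measurable_comp_nat {ρ : ℕ → Ω → ℝ} (hρ : ∀ k, Measurable (ρ k)) {φ : ℝ → ℕ}
    (hφ : Measurable φ) : Measurable fun p : ℝ × Ω => ρ (φ p.1) p.2 := by
  have h1 : Measurable fun q : ℕ × Ω => ρ q.1 q.2 := measurable_from_prod_countable_right hρ
  exact h1.comp ((hφ.comp measurable_fst).prodMk measurable_snd)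

/-- Joint measurability, from right-continuity: `σ t` is the limit of the values of `σ` at the
points of the grids `ℕ / n` next to the right of `t`. -/
theorem IsSubordinator.aemeasurable_uncurry [SFinite P] (hσ : IsSubordinator σ P) :
    AEMeasurable (fun p : ℝ × Ω => σ p.1.toNNReal p.2)
      (((volume : Measure ℝ).restrict (Ici 0)).prod P) := by
  let τ : ℕ → ℕ → ℝ≥0 := fun n k => (k + 1) / (n + 1)
  have happrox : ∀ n : ℕ, Measurable fun p : ℝ × Ω =>
      σ (τ n ⌊p.1.toNNReal * ((n : ℝ≥0) + 1)⌋₊) p.2 := by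
    intro n
    exact measurable_comp_nat (fun k => hσ.measurable (τ n k))
      (φ := fun t => ⌊t.toNNReal * ((n : ℝ≥0) + 1)⌋₊) (by fun_prop)
  refine aemeasurable_of_tendsto_metrizable_ae atTop (fun n => (happrox n).aemeasurable) ?_
  have hae : ∀ᵐ p ∂(((volume : Measure ℝ).restrict (Ici 0)).prod P),
      ∀ t : ℝ≥0, ContinuousWithinAt (fun s => σ s p.2) (Ici t) t :=
    Measure.quasiMeasurePreserving_snd.ae hσ.rightCts_paths
  filter_upwards [hae] with p hp
  have hlim : Tendsto (fun n : ℕ => τ n ⌊p.1.toNNReal * ((n : ℝ≥0) + 1)⌋₊) atTop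
      (𝓝[≥] p.1.toNNReal) := by
    set t := p.1.toNNReal
    refine tendsto_nhdsWithin_of_tendsto_nhds_of_eventually_within _ ?_ ?_
    · have hb : Tendsto (fun n : ℕ => t + 1 / ((n : ℝ≥0) + 1)) atTop (𝓝 (t + 0)) :=
        tendsto_const_nhds.add (tendsto_one_div_add_atTop_nhds_zero_nat (𝕜 := ℝ≥0))
      rw [add_zero] at hb
      refine tendsto_of_tendsto_of_tendsto_of_le_of_le tendsto_const_nhds hb (fun n => ?_) fun n => ?_
      · have hn : (0 : ℝ≥0) < (n : ℝ≥0) + 1 := by positivity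
        simp only [τ]
        rw [le_div_iff₀ hn]
        exact (Nat.lt_floor_add_one _).le
      · have hn : (0 : ℝ≥0) < (n : ℝ≥0) + 1 := by positivity
        simp only [τ]
        rw [div_le_iff₀ hn, add_mul, one_div_mul_cancel hn.ne']
        gcongr
        exact Nat.floor_le (by positivity)
    · refine Eventually.of_forall fun n => ?_
      have hn : (0 : ℝ≥0) < (n : ℝ≥0) + 1 := by positivity
      rw [mem_Ici, le_div_iff₀ hn]
      exact (Nat.lt_floor_add_one _).le
  exact (hp _).tendsto.comp hlim

theorem IsSubordinator.ae_nonneg (hσ : IsSubordinator σ P) : ∀ᵐ ω ∂P, ∀ t, 0 ≤ σ t ω := by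
  filter_upwards [hσ.start_zero, hσ.monotone_paths] with ω h0 hm t
  exact h0.symm.le.trans (hm (zero_le (a := t)))

theorem IsSubordinator.potentialMeasure_Iio [SFinite P] (hσ : IsSubordinator σ P) :
    potentialMeasure σ P (Iio 0) = 0 := by
  rw [potentialMeasure, Measure.map_apply_of_aemeasurable hσ.aemeasurable_uncurry measurableSet_Iio]
  have := Measure.quasiMeasurePreserving_snd (μ := (volume : Measure ℝ).restrict (Ici 0)).ae
    hσ.ae_nonneg
  refine measure_mono_null (fun p hp => ?_) (ae_iff.1 this)
  simp only [mem_preimage, mem_Iio] at hp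
  exact fun h => absurd (h _) (not_le.2 hp)

theorem lintegral_Ioi_exp_neg_mul {c : ℝ} (hc : 0 < c) :
    ∫⁻ s in Ioi 0, ENNReal.ofReal (Real.exp (-(c * s))) = ENNReal.ofReal (1 / c) := by
  have h1 := integrableOn_exp_mul_Ioi (neg_lt_zero.2 hc) 0
  have h2 := integral_exp_mul_Ioi (neg_lt_zero.2 hc) 0
  simp only [neg_mul, mul_zero, Real.exp_zero, neg_div_neg_eq] at h1 h2
  rw [← h2, ofReal_integral_eq_lintegral_ofReal h1 (ae_of_all _ fun x => (Real.exp_pos _).le)]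

theorem IsSubordinator.laplace_potentialMeasure [IsProbabilityMeasure P] (hσ : IsSubordinator σ P)
    (hσΦ : HasLaplaceExponent σ P Φ) {z : ℝ} (hz : 0 < z) (hΦ : 0 < Φ z) :
    ∫⁻ x, ENNReal.ofReal (Real.exp (-(z * x))) ∂(potentialMeasure σ P)
      = ENNReal.ofReal (1 / Φ z) := by
  rw [potentialMeasure, lintegral_map' (by fun_prop) hσ.aemeasurable_uncurry]
  have hm : AEMeasurable (fun p : ℝ × Ω => ENNReal.ofReal (Real.exp (-(z * σ p.1.toNNReal p.2))))
      (((volume : Measure ℝ).restrict (Ici 0)).prod P) :=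
    (show Measurable fun y : ℝ => ENNReal.ofReal (Real.exp (-(z * y))) by
      fun_prop).comp_aemeasurable hσ.aemeasurable_uncurry
  rw [lintegral_prod _ hm, ← lintegral_Ioi_exp_neg_mul hΦ, ← restrict_Ioi_eq_restrict_Ici]
  refine setLIntegral_congr_fun measurableSet_Ioi fun s hs => ?_
  have hint : Integrable (fun ω => Real.exp (-(z * σ s.toNNReal ω))) P := by
    have := hσ.measurable s.toNNReal
    refine Integrable.of_bound (by fun_prop) 1 ?_
    filter_upwards [hσ.ae_nonneg] with ω hω
    rw [Real.norm_of_nonneg (Real.exp_pos _).le]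
    exact Real.exp_le_one_iff.2 (neg_nonpos.2 (mul_nonneg hz.le (hω _)))
  have h := hσΦ s.toNNReal z hz
  simp only
  rw [← ofReal_integral_eq_lintegral_ofReal hint (ae_of_all _ fun x => (Real.exp_pos _).le), h,
    Real.coe_toNNReal _ (le_of_lt hs), mul_comm]

end Potential

/-! ### Special Bernstein functions -/

section Special

variable {U : Measure ℝ} {Φ : ℝ → ℝ}

theorem IsSpecialBernstein.pos (h : IsSpecialBernstein Φ) {z : ℝ} (hz : 0 < z) : 0 < Φ z :=
  lt_of_le_of_ne (h.isBernstein.nonneg z hz) (h.ne_zero z hz).symm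

/-- The derivatives of `z ↦ z ∫ e^{-zx} U(dx)`, by Leibniz' rule. -/
theorem iteratedDeriv_mul_laplace
    (hfin : ∀ z : ℝ, 0 < z → ∫⁻ x, ENNReal.ofReal (Real.exp (-(z * x))) ∂U ≠ ∞) {H : ℝ → ℝ}
    (hH : ∀ z, 0 < z → H z = z * ∫ x, Real.exp (-z * x) ∂U) (n : ℕ) :
    ∀ z : ℝ, 0 < z → iteratedDeriv (n + 1) H z
      = (-1) ^ (n + 1) * (z * ∫ x, x ^ (n + 1) * Real.exp (-z * x) ∂U
        - (n + 1) * ∫ x, x ^ n * Real.exp (-z * x) ∂U) := by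
  have hM : ∀ (k : ℕ) (z : ℝ), 0 < z → HasDerivAt (fun z => ∫ x, x ^ k * Real.exp (-z * x) ∂U)
      (-∫ x, x ^ (k + 1) * Real.exp (-z * x) ∂U) z := by
    intro k z hz
    have h1 := hasDerivAt_integral_pow_mul_exp_real
      (mem_interior_integrableExpSet hfin (neg_lt_zero.2 hz)) k
    have h2 := h1.scomp z (hasDerivAt_neg z)
    simpa [Function.comp_def] using h2
  induction n with
  | zero =>
    intro z hz
    rw [zero_add, iteratedDeriv_one]
    have h1 : HasDerivAt (fun z => z * ∫ x, x ^ 0 * Real.exp (-z * x) ∂U) _ z :=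
      (hasDerivAt_id z).mul (hM 0 z hz)
    have h2 : H =ᶠ[𝓝 z] fun z => z * ∫ x, x ^ 0 * Real.exp (-z * x) ∂U := by
      filter_upwards [Ioi_mem_nhds hz] with w hw
      simpa using hH w hw
    rw [h2.deriv_eq, h1.deriv]
    simp only [id, zero_add, Nat.cast_zero]
    ring
  | succ n ih =>
    intro z hz
    rw [iteratedDeriv_succ]
    have h1 := (((hasDerivAt_id z).mul (hM (n + 1) z hz)).sub
      ((hM n z hz).const_mul ((n : ℝ) + 1))).const_mul ((-1 : ℝ) ^ (n + 1))
    have h2 : iteratedDeriv (n + 1) H =ᶠ[𝓝 z] fun z => (-1) ^ (n + 1) *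
        (z * ∫ x, x ^ (n + 1) * Real.exp (-z * x) ∂U
          - (n + 1) * ∫ x, x ^ n * Real.exp (-z * x) ∂U) := by
      filter_upwards [Ioi_mem_nhds hz] with w hw
      exact ih w hw
    have h3 : HasDerivAt (fun z => (-1) ^ (n + 1) *
        (z * ∫ x, x ^ (n + 1) * Real.exp (-z * x) ∂U
          - (n + 1) * ∫ x, x ^ n * Real.exp (-z * x) ∂U)) _ z := h1
    rw [h2.deriv_eq, h3.deriv]
    simp only [id]
    push_cast
    ring

/-- If `z ↦ z ∫ e^{-zx} U(dx)` is a Bernstein function, the sign of its `k`-th derivative is the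
comparison of two consecutive Poisson averages of `U`. -/
theorem antitone_integral_poissonWeight
    (hfin : ∀ z : ℝ, 0 < z → ∫⁻ x, ENNReal.ofReal (Real.exp (-(z * x))) ∂U ≠ ∞) {H : ℝ → ℝ}
    (hH : ∀ z, 0 < z → H z = z * ∫ x, Real.exp (-z * x) ∂U) (hB : IsBernstein H) {z : ℝ}
    (hz : 0 < z) : Antitone fun k : ℕ => ∫ x, poissonWeight (z * x) k ∂U := by
  have hq : ∀ k : ℕ, ∫ x, poissonWeight (z * x) k ∂U
      = z ^ k / k.factorial * ∫ x, x ^ k * Real.exp (-z * x) ∂U := by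
    intro k
    rw [← integral_const_mul]
    refine integral_congr_ae (ae_of_all _ fun x => ?_)
    simp only [poissonWeight, mul_pow, neg_mul]
    ring
  refine antitone_nat_of_succ_le fun k => ?_
  rw [hq, hq]
  have h1 := hB.alternating (k + 1) (by omega) z hz
  rw [iteratedDeriv_mul_laplace hfin hH k z hz, ← mul_assoc, ← mul_pow] at h1
  norm_num at h1
  set A := ∫ x, x ^ (k + 1) * Real.exp (-(z * x)) ∂U
  set B := ∫ x, x ^ k * Real.exp (-(z * x)) ∂U
  have h2 : z ^ (k + 1) / (k + 1).factorial * A = z ^ k / (k + 1).factorial * (z * A) := by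
    rw [pow_succ]; ring
  have h3 : z ^ k / k.factorial * B = z ^ k / (k + 1).factorial * ((k + 1) * B) := by
    rw [Nat.factorial_succ]
    push_cast
    field_simp
  simp only [neg_mul]
  rw [h2, h3]
  exact mul_le_mul_of_nonneg_left h1 (by positivity)

end Special

/-! ### The Lévy measure and its tail -/

section Levy

variable {ν : Measure ℝ} {Φ : ℝ → ℝ}

theorem IsLevyTriple.restrict_Ioi {a b : ℝ} (h : IsLevyTriple Φ a b ν) :
    ν.restrict (Ioi 0) = ν := by
  refine Measure.restrict_eq_self_of_ae_mem ?_
  rw [ae_iff]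
  simpa [Iic] using h.measure_Iic

theorem IsLevyTriple.measure_Ioi_lt_top {a b : ℝ} (h : IsLevyTriple Φ a b ν) {t : ℝ} (ht : 0 < t) :
    ν (Ioi t) < ∞ := by
  have h1 := h.lintegral_lt_top
  rw [h.restrict_Ioi] at h1
  have h2 := mul_meas_ge_le_lintegral₀ (μ := ν) (f := fun x => ENNReal.ofReal (min 1 x))
    (by fun_prop) (ENNReal.ofReal (min 1 t))
  have hsub : Ioi t ⊆ {x | ENNReal.ofReal (min 1 t) ≤ ENNReal.ofReal (min 1 x)} :=
    fun x hx => ENNReal.ofReal_le_ofReal (min_le_min le_rfl (le_of_lt hx))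
  refine lt_of_le_of_lt (measure_mono hsub) ?_
  refine ENNReal.lt_top_of_mul_ne_top_right (h2.trans_lt h1).ne ?_
  simp [ht]

theorem IsLevyTriple.ae_pos {a b : ℝ} (h : IsLevyTriple Φ a b ν) : ∀ᵐ x ∂ν, 0 < x := by
  rw [ae_iff]
  simpa [Iic] using h.measure_Iic

theorem one_sub_exp_neg_mul_nonneg {z x : ℝ} (hz : 0 < z) (hx : 0 < x) :
    0 ≤ 1 - Real.exp (-(z * x)) :=
  sub_nonneg.2 (Real.exp_le_one_iff.2 (neg_nonpos.2 (mul_pos hz hx).le))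

theorem IsLevyTriple.lintegral_one_sub_exp (h : IsLevyTriple Φ 0 0 ν) {z : ℝ} (hz : 0 < z) :
    ∫⁻ x, ENNReal.ofReal (1 - Real.exp (-(z * x))) ∂ν = ENNReal.ofReal (Φ z) := by
  have h1 := h.lintegral_lt_top
  have h2 := h.eq_integral z hz
  rw [h.restrict_Ioi] at h1 h2
  rw [h2, zero_mul, add_zero, zero_add, ofReal_integral_eq_lintegral_ofReal]
  · have hint : Integrable (fun x : ℝ => min 1 x) ν := by
      refine ⟨by fun_prop, ?_⟩
      rw [hasFiniteIntegral_iff_ofReal]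
      · exact h1
      · filter_upwards [h.ae_pos] with x hx
        exact le_min zero_le_one hx.le
    refine (hint.const_mul (max 1 z)).mono' (by fun_prop) ?_
    filter_upwards [h.ae_pos] with x hx
    rw [Real.norm_of_nonneg (one_sub_exp_neg_mul_nonneg hz hx)]
    have h3 := Real.add_one_le_exp (-(z * x))
    rcases le_total 1 x with h4 | h4
    · rw [min_eq_left h4, mul_one]
      exact (sub_le_self _ (Real.exp_pos _).le).trans (le_max_left _ _)
    · rw [min_eq_right h4]
      have : z * x ≤ max 1 z * x := mul_le_mul_of_nonneg_right (le_max_right _ _) hx.le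
      linarith
  · filter_upwards [h.ae_pos] with x hx
    exact one_sub_exp_neg_mul_nonneg hz hx

/-- `Φ` is unbounded when `ν` is infinite, by monotone convergence. -/
theorem IsLevyTriple.tendsto_ofReal_atTop (h : IsLevyTriple Φ 0 0 ν) (hinf : ν (Ioi 0) = ∞) :
    Tendsto (fun n : ℕ => ENNReal.ofReal (Φ (n + 1))) atTop (𝓝 ∞) := by
  have hv : ν univ = ∞ := by
    rw [← h.restrict_Ioi, Measure.restrict_apply_univ, hinf]
  have h1 : Tendsto (fun n : ℕ => ∫⁻ x, ENNReal.ofReal (1 - Real.exp (-(((n : ℝ) + 1) * x))) ∂ν)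
      atTop (𝓝 (∫⁻ _, 1 ∂ν)) := by
    refine lintegral_tendsto_of_tendsto_of_monotone (fun n => by fun_prop) ?_ ?_
    · filter_upwards [h.ae_pos] with x hx n m hnm
      refine ENNReal.ofReal_le_ofReal (sub_le_sub_left (Real.exp_le_exp.2 (neg_le_neg ?_)) _)
      gcongr
    · filter_upwards [h.ae_pos] with x hx
      have e1 : Tendsto (fun n : ℕ => ((n : ℝ) + 1) * x) atTop atTop :=
        (tendsto_natCast_atTop_atTop.atTop_add tendsto_const_nhds).atTop_mul_const hx
      have e2 := (Real.tendsto_exp_neg_atTop_nhds_zero.comp e1).const_sub 1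
      have e3 := ENNReal.tendsto_ofReal e2
      simpa using e3
  rw [lintegral_one, hv] at h1
  refine h1.congr fun n => ?_
  exact h.lintegral_one_sub_exp (by positivity)

/-- The measure `ν̄(t) dt` on `(0, ∞)`. -/
noncomputable def tailMeasure (ν : Measure ℝ) : Measure ℝ :=
  (volume.restrict (Ioi 0)).withDensity fun t => ν (Ioi t)

theorem measurable_measure_Ioi (ν : Measure ℝ) : Measurable fun t => ν (Ioi t) :=
  Antitone.measurable fun _ _ h => measure_mono (Ioi_subset_Ioi h)

instance (ν : Measure ℝ) : SFinite (tailMeasure ν) := by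
  unfold tailMeasure; infer_instance

/-- The layer cake formula for `∫ (1 - e^{-zx}) / z ν(dx)`. -/
theorem IsLevyTriple.laplace_tailMeasure (h : IsLevyTriple Φ 0 0 ν) {z : ℝ} (hz : 0 < z) :
    ∫⁻ x, ENNReal.ofReal (Real.exp (-(z * x))) ∂(tailMeasure ν) = ENNReal.ofReal (Φ z / z) := by
  have h1 := lintegral_comp_eq_lintegral_meas_lt_mul ν (f := id)
    (g := fun t => Real.exp (-(z * t))) (by filter_upwards [h.ae_pos] with x hx using hx.le)
    aemeasurable_id (fun t _ => by apply Continuous.intervalIntegrable; fun_prop)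
    (ae_of_all _ fun t => (Real.exp_pos _).le)
  have h2 : ∀ x : ℝ, ∫ t in (0 : ℝ)..x, Real.exp (-(z * t)) = z⁻¹ * (1 - Real.exp (-(z * x))) := by
    intro x
    have e : ∀ t ∈ uIcc 0 x, HasDerivAt (fun t => -z⁻¹ * Real.exp (-(z * t)))
        (Real.exp (-(z * t))) t := by
      intro t _
      have e1 : HasDerivAt (fun t => -(z * t)) (-(z * 1)) t := ((hasDerivAt_id t).const_mul z).neg
      refine (e1.exp.const_mul (-z⁻¹)).congr_deriv ?_
      field_simp
    rw [intervalIntegral.integral_eq_sub_of_hasDerivAt e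
      (by apply Continuous.intervalIntegrable; fun_prop)]
    simp only [mul_zero, neg_zero, Real.exp_zero]
    ring
  rw [tailMeasure, lintegral_withDensity_eq_lintegral_mul _ (measurable_measure_Ioi ν)
    (by fun_prop)]
  simp only [Pi.mul_apply]
  refine Eq.trans h1.symm ?_
  simp only [id, h2, ENNReal.ofReal_mul (inv_pos.2 hz).le]
  rw [lintegral_const_mul _ (by fun_prop), h.lintegral_one_sub_exp hz,
    ← ENNReal.ofReal_mul (inv_pos.2 hz).le]
  congr 1
  ring

end Levy

/-! ### The resolvent identity -/

section Resolvent

variable {ν U : Measure ℝ} {Φ : ℝ → ℝ}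

/-- The Laplace transforms `1 / Φ(z)` and `Φ(z) / z` multiply to that of Lebesgue measure on
`(0, ∞)`. -/
theorem conv_tailMeasure [SFinite U] (h : IsLevyTriple Φ 0 0 ν) (hpos : ∀ z, 0 < z → 0 < Φ z)
    (hU : ∀ z : ℝ, 0 < z → ∫⁻ x, ENNReal.ofReal (Real.exp (-(z * x))) ∂U
      = ENNReal.ofReal (1 / Φ z)) :
    Measure.conv U (tailMeasure ν) = volume.restrict (Ioi 0) := by
  have key : ∀ z : ℝ, 0 < z →
      ∫⁻ x, ENNReal.ofReal (Real.exp (-(z * x))) ∂(Measure.conv U (tailMeasure ν))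
        = ENNReal.ofReal (1 / z) := by
    intro z hz
    rw [Measure.lintegral_conv (by fun_prop)]
    simp only [mul_add, neg_add, Real.exp_add, ENNReal.ofReal_mul (Real.exp_pos _).le]
    simp_rw [lintegral_const_mul _ (show Measurable fun y : ℝ =>
      ENNReal.ofReal (Real.exp (-(z * y))) by fun_prop)]
    rw [lintegral_mul_const _ (by fun_prop), hU z hz, h.laplace_tailMeasure hz,
      ← ENNReal.ofReal_mul (one_div_pos.2 (hpos z hz)).le]
    congr 1
    have := (hpos z hz).ne'
    field_simp
  refine ext_of_laplace (fun z hz => ?_) fun z hz => ?_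
  · rw [key z hz]
    exact ENNReal.ofReal_ne_top
  · rw [key z hz, lintegral_Ioi_exp_neg_mul hz]

end Resolvent

/-! ### Causal convolution -/

/-- Measures against which bounded functions on `[0, ∞)` can be convolved: Lebesgue-absolutely
continuous, carried by `(0, ∞)` and finite on bounded sets. -/
structure IsCausalKernel (μ : Measure ℝ) : Prop where
  absCts : μ ≪ volume
  Iic_zero : μ (Iic 0) = 0
  finite : ∀ b, μ (Iic b) < ∞

/-- Essentially bounded measurable functions, by `M`, that vanish on `(-∞, 0)`. -/
structure IsCausal {X : Type*} [NormedAddCommGroup X] (M : ℝ) (φ : ℝ → X) : Prop where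
  aestronglyMeasurable : AEStronglyMeasurable φ volume
  bound : ∀ᵐ t, ‖φ t‖ ≤ M
  zero : ∀ t, t < 0 → φ t = 0

/-- The convolution `t ↦ ∫ φ (t - x) μ(dx)`. -/
noncomputable def convolve {X : Type*} [NormedAddCommGroup X] [NormedSpace ℝ X] (μ : Measure ℝ)
    (φ : ℝ → X) (t : ℝ) : X := ∫ x, φ (t - x) ∂μ

section Kernel

variable {X : Type*} [NormedAddCommGroup X]
variable {μ μ₁ μ₂ : Measure ℝ} {φ ψ : ℝ → X} {M t : ℝ}

theorem IsCausalKernel.isLocallyFiniteMeasure (hμ : IsCausalKernel μ) : IsLocallyFiniteMeasure μ :=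
  ⟨fun x => ⟨Iic (x + 1), Iic_mem_nhds (lt_add_one x), hμ.finite _⟩⟩

theorem IsCausalKernel.sigmaFinite (hμ : IsCausalKernel μ) : SigmaFinite μ := by
  have := hμ.isLocallyFiniteMeasure
  infer_instance

theorem IsCausalKernel.ae_pos (hμ : IsCausalKernel μ) : ∀ᵐ x ∂μ, 0 < x := by
  rw [ae_iff]
  simpa [Iic] using hμ.Iic_zero

theorem IsCausalKernel.quasiMeasurePreserving (hμ : IsCausalKernel μ) (t : ℝ) :
    Measure.QuasiMeasurePreserving (fun x => t - x) μ volume :=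
  ((Measure.measurePreserving_sub_left volume t).quasiMeasurePreserving).mono_left hμ.absCts

theorem isCausalKernel_restrict_Ioi : IsCausalKernel ((volume : Measure ℝ).restrict (Ioi 0)) where
  absCts := Measure.restrict_le_self.absolutelyContinuous
  Iic_zero := by
    rw [Measure.restrict_apply measurableSet_Iic, inter_comm, Ioi_inter_Iic, Ioc_self,
      measure_empty]
  finite b := by
    rw [Measure.restrict_apply measurableSet_Iic, inter_comm, Ioi_inter_Iic]
    exact measure_Ioc_lt_top

theorem IsCausalKernel.conv (h₁ : IsCausalKernel μ₁) (h₂ : IsCausalKernel μ₂) :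
    IsCausalKernel (Measure.conv μ₁ μ₂) := by
  have s₁ := h₁.sigmaFinite
  have s₂ := h₂.sigmaFinite
  have hae : ∀ᵐ p ∂(μ₁.prod μ₂), 0 < p.1 ∧ 0 < p.2 := by
    filter_upwards [Measure.quasiMeasurePreserving_fst.ae h₁.ae_pos,
      Measure.quasiMeasurePreserving_snd.ae h₂.ae_pos] with p hp1 hp2 using ⟨hp1, hp2⟩
  refine ⟨Measure.conv_absolutelyContinuous h₂.absCts, ?_, fun b => ?_⟩
  · rw [Measure.conv, Measure.map_apply (by fun_prop) measurableSet_Iic]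
    refine measure_mono_null (fun p hp => ?_) (ae_iff.1 hae)
    simp only [mem_preimage, mem_Iic] at hp
    intro hcon
    linarith [hcon.1, hcon.2]
  · rw [Measure.conv, Measure.map_apply (by fun_prop) measurableSet_Iic]
    refine lt_of_le_of_lt (measure_mono_ae (t := Iic b ×ˢ Iic b) ?_) ?_
    · filter_upwards [hae] with p hp hpb
      have hpb' : p.1 + p.2 ≤ b := hpb
      exact ⟨by rw [mem_Iic]; linarith [hp.2], by rw [mem_Iic]; linarith [hp.1]⟩
    · rw [Measure.prod_prod]
      exact ENNReal.mul_lt_top (h₁.finite b) (h₂.finite b)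

theorem IsCausal.nonneg_bound (hφ : IsCausal M φ) : 0 ≤ M := by
  obtain ⟨t, ht⟩ := hφ.bound.exists
  exact (norm_nonneg _).trans ht

theorem IsCausal.sub {M' : ℝ} (hφ : IsCausal M φ) (hψ : IsCausal M ψ)
    (hd : ∀ᵐ t, ‖φ t - ψ t‖ ≤ M') : IsCausal M' fun t => φ t - ψ t :=
  ⟨hφ.aestronglyMeasurable.sub hψ.aestronglyMeasurable, hd, fun t ht => by
    rw [hφ.zero t ht, hψ.zero t ht, sub_zero]⟩

theorem IsCausal.integrable_comp_sub (hφ : IsCausal M φ) (hμ : IsCausalKernel μ) (t : ℝ) :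
    Integrable (fun x => φ (t - x)) μ := by
  have h : IntegrableOn (fun x => φ (t - x)) (Iic t) μ := by
    refine IntegrableOn.of_bound (hμ.finite t) ?_ M ?_
    · exact (hφ.aestronglyMeasurable.comp_quasiMeasurePreserving
        (hμ.quasiMeasurePreserving t)).restrict
    · exact ae_restrict_of_ae ((hμ.quasiMeasurePreserving t).ae hφ.bound)
  refine (integrableOn_iff_integrable_of_support_subset fun x hx => ?_).1 h
  by_contra hcon
  exact hx (hφ.zero _ (by simpa using hcon))

theorem IsCausal.intervalIntegrable (hφ : IsCausal M φ) (a b : ℝ) :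
    IntervalIntegrable φ volume a b :=
  (intervalIntegrable_const (c := M)).mono_fun hφ.aestronglyMeasurable.restrict
    (ae_restrict_of_ae (hφ.bound.mono fun _ ht => ht.trans (le_abs_self M)))

variable [NormedSpace ℝ X]

theorem IsCausal.norm_convolve_le (hφ : IsCausal M φ) (hμ : IsCausalKernel μ) (t : ℝ) :
    ‖convolve μ φ t‖ ≤ M * μ.real (Iic t) := by
  rw [convolve, ← setIntegral_eq_integral_of_forall_compl_eq_zero (s := Iic t)
    fun x hx => hφ.zero _ (by simpa using hx)]
  exact norm_setIntegral_le_of_norm_le_const_ae (hμ.finite t)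
    (ae_restrict_of_ae ((hμ.quasiMeasurePreserving t).ae hφ.bound))

theorem IsCausal.convolve_of_nonpos (hφ : IsCausal M φ) (hμ : IsCausalKernel μ) (ht : t ≤ 0) :
    convolve μ φ t = 0 := by
  have h1 : μ (Iic t) = 0 := measure_mono_null (Iic_subset_Iic.2 ht) hμ.Iic_zero
  have h := hφ.norm_convolve_le hμ t
  rw [Measure.real, h1, ENNReal.toReal_zero, mul_zero] at h
  exact norm_le_zero_iff.1 h

theorem convolve_sub (hφ : IsCausal M φ) (hψ : IsCausal M ψ) (hμ : IsCausalKernel μ) (t : ℝ) :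
    convolve μ (fun s => φ s - ψ s) t = convolve μ φ t - convolve μ ψ t :=
  integral_sub (hφ.integrable_comp_sub hμ t) (hψ.integrable_comp_sub hμ t)

theorem convolve_congr (hμ : IsCausalKernel μ) (h : ∀ s, s ≤ t → φ s = ψ s) :
    convolve μ φ t = convolve μ ψ t := by
  refine integral_congr_ae ?_
  filter_upwards [hμ.ae_pos] with x hx
  exact h _ (by linarith)

/-- Convolutions compose, by Fubini's theorem. -/
theorem IsCausal.convolve_convolve (hφ : IsCausal M φ) (h₁ : IsCausalKernel μ₁)
    (h₂ : IsCausalKernel μ₂) (t : ℝ) :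
    convolve μ₁ (convolve μ₂ φ) t = convolve (Measure.conv μ₁ μ₂) φ t := by
  have s₁ := h₁.sigmaFinite
  have s₂ := h₂.sigmaFinite
  have hint := hφ.integrable_comp_sub (h₁.conv h₂) t
  have hmeas := hint.aestronglyMeasurable
  rw [Measure.conv] at hint hmeas
  have hint' := (integrable_map_measure hmeas (by fun_prop)).1 hint
  rw [convolve, convolve, Measure.conv, integral_map (by fun_prop) hmeas]
  refine Eq.trans ?_ (integral_prod _ hint').symm
  refine integral_congr_ae (ae_of_all _ fun x => ?_)
  simp only [convolve, Function.comp_def, sub_sub]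

theorem IsCausal.convolve_restrict_Ioi (hφ : IsCausal M φ) (ht : 0 ≤ t) :
    convolve (volume.restrict (Ioi 0)) φ t = ∫ s in (0 : ℝ)..t, φ s := by
  have h1 : convolve (volume.restrict (Ioi 0)) φ t = ∫ x in Ioc 0 t, φ (t - x) := by
    rw [convolve]
    refine (setIntegral_eq_of_subset_of_forall_sdiff_eq_zero measurableSet_Ioi
      Ioc_subset_Ioi_self fun x hx => hφ.zero _ ?_)
    have : t < x := not_le.1 fun h => hx.2 ⟨hx.1, h⟩
    linarith
  rw [h1, ← intervalIntegral.integral_of_le ht, intervalIntegral.integral_comp_sub_left]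
  simp

end Kernel

/-! ### Hölder regularity -/

section Holder

variable {X : Type*} [NormedAddCommGroup X] [NormedSpace ℝ X]
variable {U : Measure ℝ} {φ : ℝ → X} {M : ℝ}

/-- If `U` decreases under shifts, the modulus of continuity of `U * φ` is controlled by
`h ↦ U (0, h]`. The increment splits into an integral over `(0, h]` and one against the difference
of `U` and its shift, which is a positive measure whose mass on `(0, t]` is at most `U (0, h]`. -/
theorem IsCausal.norm_convolve_add_sub_le (hφ : IsCausal M φ) (hU : IsCausalKernel U)
    (hshift : ∀ h : ℝ, 0 < h → ∀ A : Set ℝ, MeasurableSet A → A ⊆ Ioi 0 →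
      U ((fun x => x - h) ⁻¹' A) ≤ U A) {t h : ℝ} (hh : 0 < h) :
    ‖convolve U φ (t + h) - convolve U φ t‖ ≤ 2 * M * U.real (Iic h) := by
  have hM := hφ.nonneg_bound
  have hτ : Measurable fun x : ℝ => x - h := by fun_prop
  -- `V` is the shift of `U`, restricted to `(0, t]`, and `W` is the restriction of `U`
  set V : Measure ℝ := (U.map fun x => x - h).restrict (Ioc 0 t) with hV
  set W : Measure ℝ := U.restrict (Ioc 0 t) with hW
  have hVW : V ≤ W := by
    refine Measure.le_iff.2 fun A hA => ?_
    rw [hV, hW, Measure.restrict_apply hA, Measure.restrict_apply hA,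
      Measure.map_apply hτ (hA.inter measurableSet_Ioc)]
    exact hshift h hh _ (hA.inter measurableSet_Ioc) fun x hx => hx.2.1
  have hWfin : IsFiniteMeasure W :=
    ⟨by
      rw [hW, Measure.restrict_apply_univ]
      exact (measure_mono Ioc_subset_Iic_self).trans_lt (hU.finite t)⟩
  have hVfin : IsFiniteMeasure V := isFiniteMeasure_of_le W hVW
  have hsum : W - V + V = W := Measure.sub_add_cancel_of_le hVW
  have hWint : Integrable (fun x => φ (t - x)) W := (hφ.integrable_comp_sub hU t).restrict
  have hVint : Integrable (fun x => φ (t - x)) V := hWint.mono_measure hVW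
  have hDint : Integrable (fun x => φ (t - x)) (W - V) := hWint.mono_measure Measure.sub_le
  have hpos := hU.ae_pos
  -- the convolution at `t`
  have e1 : convolve U φ t = ∫ x, φ (t - x) ∂W := by
    rw [convolve, hW]
    refine (setIntegral_eq_integral_of_ae_compl_eq_zero ?_).symm
    filter_upwards [hpos] with x hx hxt
    refine hφ.zero _ ?_
    have : t < x := not_le.1 fun h => hxt ⟨hx, h⟩
    linarith
  have e2 : ∫ x, φ (t - x) ∂W = ∫ x, φ (t - x) ∂(W - V) + ∫ x, φ (t - x) ∂V := by
    rw [← integral_add_measure hDint hVint, hsum]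
  -- the convolution at `t + h`
  have e3 : convolve U φ (t + h)
      = ∫ x in Iic h, φ (t + h - x) ∂U + ∫ x in Ioi h, φ (t + h - x) ∂U := by
    rw [convolve, ← compl_Iic, integral_add_compl measurableSet_Iic
      (hφ.integrable_comp_sub hU (t + h))]
  have e4 : ∫ x in Ioi h, φ (t + h - x) ∂U = ∫ x, φ (t - x) ∂V := by
    have hpre : (fun x => x - h) ⁻¹' Ioc 0 t = Ioc h (t + h) := by
      ext x
      simp only [mem_preimage, mem_Ioc, sub_pos, sub_le_iff_le_add]
    have hVmap : V = (U.restrict (Ioc h (t + h))).map fun x => x - h := by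
      rw [hV, Measure.restrict_map hτ measurableSet_Ioc, hpre]
    have hm := hVint.aestronglyMeasurable
    rw [hVmap] at hm ⊢
    rw [integral_map hτ.aemeasurable hm]
    have : ∀ x, t - (x - h) = t + h - x := fun x => by ring
    simp only [this]
    refine setIntegral_eq_of_subset_of_forall_sdiff_eq_zero measurableSet_Ioi
      Ioc_subset_Ioi_self fun x hx => hφ.zero _ ?_
    have : t + h < x := not_le.1 fun h' => hx.2 ⟨hx.1, h'⟩
    linarith
  have b1 : ‖∫ x in Iic h, φ (t + h - x) ∂U‖ ≤ M * U.real (Iic h) :=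
    norm_setIntegral_le_of_norm_le_const_ae (hU.finite h)
      (ae_restrict_of_ae ((hU.quasiMeasurePreserving (t + h)).ae hφ.bound))
  have b2 : ‖∫ x, φ (t - x) ∂(W - V)‖ ≤ M * (W - V).real univ := by
    refine norm_integral_le_of_norm_le_const ?_
    have : W - V ≪ U :=
      (Measure.sub_le.absolutelyContinuous).trans Measure.restrict_le_self.absolutelyContinuous
    exact this.ae_le ((hU.quasiMeasurePreserving t).ae hφ.bound)
  have b3 : (W - V).real univ ≤ U.real (Iic h) := by
    refine ENNReal.toReal_mono (hU.finite h).ne ?_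
    rw [Measure.sub_apply .univ hVW, hW, hV, Measure.restrict_apply_univ,
      Measure.restrict_apply_univ, Measure.map_apply hτ measurableSet_Ioc, tsub_le_iff_right]
    refine (measure_mono fun x hx => ?_).trans (measure_union_le _ _)
    rcases le_or_gt x h with hxh | hxh
    · exact Or.inl hxh
    · refine Or.inr ⟨?_, ?_⟩
      · linarith
      · have := hx.2
        linarith
  have hid : convolve U φ (t + h) - convolve U φ t
      = ∫ x in Iic h, φ (t + h - x) ∂U - ∫ x, φ (t - x) ∂(W - V) := by
    rw [e3, e4, e1, e2]
    abel
  rw [hid]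
  refine (norm_sub_le _ _).trans ?_
  have := mul_le_mul_of_nonneg_left b3 hM
  linarith

end Holder

/-! ### Convolution with the tail of the Lévy measure -/

section Tail

variable {X : Type*} [NormedAddCommGroup X] [NormedSpace ℝ X]
variable {ν : Measure ℝ} {Φ : ℝ → ℝ} {g : ℝ → X} {M t : ℝ}

theorem IsLevyTriple.isCausalKernel_tailMeasure (h : IsLevyTriple Φ 0 0 ν) :
    IsCausalKernel (tailMeasure ν) where
  absCts := (withDensity_absolutelyContinuous _ _).trans
    Measure.restrict_le_self.absolutelyContinuous
  Iic_zero := withDensity_absolutelyContinuous _ _ isCausalKernel_restrict_Ioi.Iic_zero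
  finite := measure_Iic_lt_top fun z hz => by
    rw [h.laplace_tailMeasure hz]
    exact ENNReal.ofReal_ne_top

theorem IsLevyTriple.ae_measure_Ioi_lt_top (h : IsLevyTriple Φ 0 0 ν) :
    ∀ᵐ t ∂(volume.restrict (Ioi (0 : ℝ))), ν (Ioi t) < ∞ := by
  filter_upwards [ae_restrict_mem measurableSet_Ioi] with t ht
  exact h.measure_Ioi_lt_top ht

theorem IsCausal.intervalIntegrable_levyTail_smul (hg : IsCausal M g) (h : IsLevyTriple Φ 0 0 ν)
    (ht : 0 ≤ t) : IntervalIntegrable (fun s => levyTail ν (t - s) • g s) volume 0 t := by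
  have h1 := hg.integrable_comp_sub h.isCausalKernel_tailMeasure t
  rw [tailMeasure, integrable_withDensity_iff_integrable_smul' (measurable_measure_Ioi ν)
    h.ae_measure_Ioi_lt_top] at h1
  have h2 : IntervalIntegrable (fun x => levyTail ν x • g (t - x)) volume 0 t :=
    (intervalIntegrable_iff_integrableOn_Ioc_of_le ht).2
      (IntegrableOn.mono_set h1 Ioc_subset_Ioi_self)
  have h3 := (h2.comp_sub_left t).symm
  simpa using h3

theorem IsCausal.convolve_tailMeasure (hg : IsCausal M g) (h : IsLevyTriple Φ 0 0 ν)
    (ht : 0 ≤ t) :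
    convolve (tailMeasure ν) g t = ∫ s in (0 : ℝ)..t, levyTail ν (t - s) • g s := by
  rw [convolve, tailMeasure, integral_withDensity_eq_integral_toReal_smul (measurable_measure_Ioi ν)
    h.ae_measure_Ioi_lt_top]
  have h1 : ∫ x in Ioi 0, (ν (Ioi x)).toReal • g (t - x)
      = ∫ x in Ioc 0 t, levyTail ν x • g (t - x) := by
    refine (setIntegral_eq_of_subset_of_forall_sdiff_eq_zero measurableSet_Ioi
      Ioc_subset_Ioi_self fun x hx => ?_)
    have : t < x := not_le.1 fun h => hx.2 ⟨hx.1, h⟩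
    rw [hg.zero _ (by linarith), smul_zero]
  have h2 := intervalIntegral.integral_comp_sub_left (a := 0) (b := t)
    (fun x => levyTail ν x • g (t - x)) t
  simp only [sub_sub_cancel, sub_self, sub_zero] at h2
  rw [h1, ← intervalIntegral.integral_of_le ht, h2]

end Tail

/-! ### The potential measure of a special subordinator -/

section SpecialPotential

variable {Ω : Type*} [MeasurableSpace Ω] {P : Measure Ω} [IsProbabilityMeasure P]
  {Φ : ℝ → ℝ} {ν : Measure ℝ} {σ : ℝ≥0 → Ω → ℝ} {β : ℝ}

theorem StandingAssumption.laplace (hΦ : StandingAssumption Φ ν σ P β) (hσ : IsSubordinator σ P)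
    (hσΦ : HasLaplaceExponent σ P Φ) {z : ℝ} (hz : 0 < z) :
    ∫⁻ x, ENNReal.ofReal (Real.exp (-(z * x))) ∂(potentialMeasure σ P)
      = ENNReal.ofReal (1 / Φ z) :=
  hσ.laplace_potentialMeasure hσΦ hz (hΦ.special.pos hz)

theorem StandingAssumption.laplace_ne_top (hΦ : StandingAssumption Φ ν σ P β)
    (hσ : IsSubordinator σ P) (hσΦ : HasLaplaceExponent σ P Φ) {z : ℝ} (hz : 0 < z) :
    ∫⁻ x, ENNReal.ofReal (Real.exp (-(z * x))) ∂(potentialMeasure σ P) ≠ ∞ := by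
  rw [hΦ.laplace hσ hσΦ hz]
  exact ENNReal.ofReal_ne_top

/-- The potential measure of a special subordinator decreases under shifts: the conjugate of `Φ` is
`z ↦ z ∫ e^{-zx} U(dx)`. -/
theorem StandingAssumption.measure_preimage_sub_le (hΦ : StandingAssumption Φ ν σ P β)
    (hσ : IsSubordinator σ P) (hσΦ : HasLaplaceExponent σ P Φ) (h : ℝ) (hh : 0 < h) (A : Set ℝ)
    (hA : MeasurableSet A) (hA0 : A ⊆ Ioi 0) :
    potentialMeasure σ P ((fun x => x - h) ⁻¹' A) ≤ potentialMeasure σ P A := by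
  have hfin := fun z hz => hΦ.laplace_ne_top hσ hσΦ (z := z) hz
  refine GenCaputo.measure_preimage_sub_le hσ.potentialMeasure_Iio hfin (fun z hz => ?_) hh hA hA0
  refine antitone_integral_poissonWeight hfin (fun w hw => ?_) hΦ.special.conjugate_isBernstein hz
  rw [conjugate, integral_eq_lintegral_of_nonneg_ae (ae_of_all _ fun x => (Real.exp_pos _).le)
    (by fun_prop)]
  simp only [neg_mul]
  rw [hΦ.laplace hσ hσΦ hw, ENNReal.toReal_ofReal (one_div_pos.2 (hΦ.special.pos hw)).le]
  ring

/-- There is no atom at `0`, because `Φ` is unbounded. -/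
theorem StandingAssumption.measure_Iic_zero (hΦ : StandingAssumption Φ ν σ P β)
    (hσ : IsSubordinator σ P) (hσΦ : HasLaplaceExponent σ P Φ) :
    potentialMeasure σ P (Iic 0) = 0 := by
  have h1 : ∀ n : ℕ, potentialMeasure σ P (Iic 0) ≤ (ENNReal.ofReal (Φ (n + 1)))⁻¹ := by
    intro n
    have hz : (0 : ℝ) < n + 1 := by positivity
    rw [← ENNReal.ofReal_inv_of_pos (hΦ.special.pos hz), ← one_div, ← hΦ.laplace hσ hσΦ hz,
      ← lintegral_indicator_one measurableSet_Iic]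
    refine lintegral_mono fun x => ?_
    by_cases hx : x ∈ Iic (0 : ℝ)
    · rw [indicator_of_mem hx, Pi.one_apply, ← ENNReal.ofReal_one]
      refine ENNReal.ofReal_le_ofReal (Real.one_le_exp ?_)
      have hx' : x ≤ 0 := hx
      nlinarith
    · rw [indicator_of_notMem hx]
      exact zero_le
  have h2 : Tendsto (fun n : ℕ => (ENNReal.ofReal (Φ (n + 1)))⁻¹) atTop (𝓝 0) := by
    have := (hΦ.levy.tendsto_ofReal_atTop hΦ.infinite).inv
    simpa using this
  exact le_antisymm (ge_of_tendsto' h2 h1) bot_le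

theorem StandingAssumption.isCausalKernel (hΦ : StandingAssumption Φ ν σ P β)
    (hσ : IsSubordinator σ P) (hσΦ : HasLaplaceExponent σ P Φ) :
    IsCausalKernel (potentialMeasure σ P) where
  absCts := absolutelyContinuous_of_shift
    (measure_Iic_lt_top fun _ hz => hΦ.laplace_ne_top hσ hσΦ hz) (hΦ.measure_Iic_zero hσ hσΦ)
    (hΦ.measure_preimage_sub_le hσ hσΦ)
  Iic_zero := hΦ.measure_Iic_zero hσ hσΦ
  finite := measure_Iic_lt_top fun _ hz => hΦ.laplace_ne_top hσ hσΦ hz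

theorem StandingAssumption.conv_eq (hΦ : StandingAssumption Φ ν σ P β)
    (hσ : IsSubordinator σ P) (hσΦ : HasLaplaceExponent σ P Φ) :
    Measure.conv (potentialMeasure σ P) (tailMeasure ν) = volume.restrict (Ioi 0) := by
  have := (hΦ.isCausalKernel hσ hσΦ).sigmaFinite
  exact conv_tailMeasure hΦ.levy (fun _ hz => hΦ.special.pos hz)
    fun _ hz => hΦ.laplace hσ hσΦ hz

/-- The bound on the potential density, integrated; by absolute continuity no mass escapes it. -/
theorem StandingAssumption.exists_measure_Iic_le (hΦ : StandingAssumption Φ ν σ P β)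
    (hσ : IsSubordinator σ P) (hσΦ : HasLaplaceExponent σ P Φ) :
    ∃ t₀ > (0 : ℝ), ∃ C > (0 : ℝ), ∀ h, 0 < h → h < t₀ →
      (potentialMeasure σ P).real (Iic h) ≤ C * h ^ β := by
  obtain ⟨t₀, ht₀, C, hC, hle⟩ := hΦ.density_le
  have hβ := hΦ.exponent_mem
  have hk := hΦ.isCausalKernel hσ hσΦ
  have hsf := hk.sigmaFinite
  refine ⟨t₀, ht₀, C / β, div_pos hC hβ.1, fun h hh hht => ?_⟩
  have hint : IntegrableOn (fun t : ℝ => C * t ^ (β - 1)) (Ioc 0 h) := by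
    rw [← intervalIntegrable_iff_integrableOn_Ioc_of_le hh.le]
    exact (intervalIntegral.intervalIntegrable_rpow' (by linarith [hβ.1])).const_mul C
  have hval : ∫ t in Ioc 0 h, C * t ^ (β - 1) = C / β * h ^ β := by
    rw [← intervalIntegral.integral_of_le hh.le, intervalIntegral.integral_const_mul,
      integral_rpow (Or.inl (by linarith [hβ.1])), sub_add_cancel, Real.zero_rpow hβ.1.ne']
    ring
  have hsub : Ioc 0 h ⊆ Ioo 0 t₀ := fun x hx => ⟨hx.1, hx.2.trans_lt hht⟩
  have h1 : potentialMeasure σ P (Iic h) ≤ ENNReal.ofReal (C / β * h ^ β) := by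
    calc potentialMeasure σ P (Iic h) ≤ potentialMeasure σ P (Ioc 0 h) := by
          refine measure_mono_ae ?_
          filter_upwards [hk.ae_pos] with x hx hxh using ⟨hx, hxh⟩
      _ = ∫⁻ t in Ioc 0 h, potentialDensity σ P t := by
          rw [potentialDensity, Measure.setLIntegral_rnDeriv hk.absCts]
      _ ≤ ∫⁻ t in Ioc 0 h, ENNReal.ofReal (C * t ^ (β - 1)) :=
          lintegral_mono_ae (ae_mono (Measure.restrict_mono hsub le_rfl) hle)
      _ = ENNReal.ofReal (C / β * h ^ β) := by
          rw [← hval, ofReal_integral_eq_lintegral_ofReal hint]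
          filter_upwards [ae_restrict_mem measurableSet_Ioc] with x hx
          exact mul_nonneg hC.le (Real.rpow_nonneg hx.1.le _)
  exact ENNReal.toReal_le_of_le_ofReal
    (mul_nonneg (div_pos hC hβ.1).le (Real.rpow_nonneg hh.le _)) h1

end SpecialPotential

/-! ### The superposition operator -/

section Nemytskii

variable {X : Type*} [NormedAddCommGroup X] {F : ℝ → X → X} {T ρ C L : ℝ}

/-- The Carathéodory-type conditions on `F` over the ball of radius `ρ` about `0`, with a bound `C`
and a Lipschitz constant `L`. -/
structure IsCaratheodory (F : ℝ → X → X) (T ρ C L : ℝ) : Prop where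
  aestronglyMeasurable : ∀ x, AEStronglyMeasurable (fun t => F t x) (volume.restrict (Icc 0 T))
  bound : ∀ᵐ t ∂(volume.restrict (Icc 0 T)), ∀ x ∈ Metric.ball (0 : X) ρ, ‖F t x‖ ≤ C
  lipschitz : ∀ᵐ t ∂(volume.restrict (Icc 0 T)), ∀ x ∈ Metric.ball (0 : X) ρ,
    ∀ z ∈ Metric.ball (0 : X) ρ, ‖F t x - F t z‖ ≤ L * ‖x - z‖

theorem IsCaratheodory.mono {T' : ℝ} (hF : IsCaratheodory F T ρ C L) (h : T' ≤ T) :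
    IsCaratheodory F T' ρ C L where
  aestronglyMeasurable x := (hF.aestronglyMeasurable x).mono_set (Icc_subset_Icc_right h)
  bound := ae_restrict_of_ae_restrict_of_subset (Icc_subset_Icc_right h) hF.bound
  lipschitz := ae_restrict_of_ae_restrict_of_subset (Icc_subset_Icc_right h) hF.lipschitz

/-- The superposition `t ↦ F(t, f(t))` on `[0, T]`, extended by zero. -/
noncomputable def nemytskii (F : ℝ → X → X) (T : ℝ) (f : ℝ → X) : ℝ → X :=
  (Icc 0 T).indicator fun t => F t (f t)

theorem nemytskii_congr {f g : ℝ → X} (h : EqOn f g (Icc 0 T)) :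
    nemytskii F T f = nemytskii F T g :=
  indicator_congr fun t ht => by rw [h ht]

/-- Superpositions are measurable: approximate `f` by simple functions and use the continuity of
`F t`. -/
theorem IsCaratheodory.aestronglyMeasurable_comp (hF : IsCaratheodory F T ρ C L) {f : ℝ → X}
    (hf : StronglyMeasurable f) (hfρ : ∀ t, f t ∈ Metric.ball (0 : X) ρ) :
    AEStronglyMeasurable (fun t => F t (f t)) (volume.restrict (Icc 0 T)) := by
  have hsimple : ∀ s : SimpleFunc ℝ X,
      AEStronglyMeasurable (fun t => F t (s t)) (volume.restrict (Icc 0 T)) := by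
    intro s
    have hU : ⋃ x : s.range, s ⁻¹' {(x : X)} = univ := by
      ext t
      simp only [mem_iUnion, mem_preimage, mem_singleton_iff, mem_univ, iff_true]
      exact ⟨⟨s t, s.mem_range_self t⟩, rfl⟩
    rw [← Measure.restrict_univ (μ := volume.restrict (Icc 0 T)), ← hU,
      aestronglyMeasurable_iUnion_iff]
    intro x
    refine ((hF.aestronglyMeasurable x).restrict).congr ?_
    filter_upwards [ae_restrict_mem (s.measurableSet_fiber x)] with t ht
    rw [show s t = x from ht]
  refine aestronglyMeasurable_of_tendsto_ae atTop (fun n => hsimple (hf.approx n)) ?_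
  filter_upwards [hF.lipschitz] with t ht
  have hlim := hf.tendsto_approx t
  rw [tendsto_iff_norm_sub_tendsto_zero]
  have hz : Tendsto (fun n => L * ‖hf.approx n t - f t‖) atTop (𝓝 0) := by
    simpa using (tendsto_iff_norm_sub_tendsto_zero.1 hlim).const_mul L
  refine squeeze_zero' (Eventually.of_forall fun _ => norm_nonneg _) ?_ hz
  filter_upwards [hlim.eventually (Metric.isOpen_ball.mem_nhds (hfρ t))] with n hn
  exact ht _ hn _ (hfρ t)

theorem IsCaratheodory.isCausal_nemytskii (hF : IsCaratheodory F T ρ C L) (hC : 0 ≤ C)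
    (hT : 0 ≤ T) {f : ℝ → X} (hf : ContinuousOn f (Icc 0 T))
    (hfρ : MapsTo f (Icc 0 T) (Metric.ball (0 : X) ρ)) : IsCausal C (nemytskii F T f) where
  aestronglyMeasurable := by
    have hcont : Continuous fun t => f (projIcc 0 T hT t) :=
      (continuousOn_iff_continuous_domRestrict.1 hf).comp continuous_projIcc
    have h := hF.aestronglyMeasurable_comp hcont.stronglyMeasurable fun t => hfρ (projIcc 0 T hT t).2
    rw [nemytskii_congr (g := fun t => f (projIcc 0 T hT t))
      fun t ht => by simp only [projIcc_of_mem hT ht]]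
    exact (aestronglyMeasurable_indicator_iff measurableSet_Icc).2 h
  bound := by
    have h := (ae_restrict_iff' measurableSet_Icc).1 hF.bound
    filter_upwards [h] with t ht
    by_cases hmem : t ∈ Icc 0 T
    · rw [nemytskii, indicator_of_mem hmem]
      exact ht hmem _ (hfρ hmem)
    · rw [nemytskii, indicator_of_notMem hmem, norm_zero]
      exact hC
  zero t ht := indicator_of_notMem (fun h => absurd h.1 (not_le.2 ht)) _

theorem IsCaratheodory.norm_nemytskii_sub_le (hF : IsCaratheodory F T ρ C L) (hL : 0 ≤ L)
    {f g : ℝ → X} (hfρ : MapsTo f (Icc 0 T) (Metric.ball (0 : X) ρ))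
    (hgρ : MapsTo g (Icc 0 T) (Metric.ball (0 : X) ρ)) {d : ℝ} (hd0 : 0 ≤ d)
    (hd : ∀ t ∈ Icc 0 T, ‖f t - g t‖ ≤ d) :
    ∀ᵐ t, ‖nemytskii F T f t - nemytskii F T g t‖ ≤ L * d := by
  have h := (ae_restrict_iff' measurableSet_Icc).1 hF.lipschitz
  filter_upwards [h] with t ht
  by_cases hmem : t ∈ Icc 0 T
  · rw [nemytskii, nemytskii, indicator_of_mem hmem, indicator_of_mem hmem]
    exact (ht hmem _ (hfρ hmem) _ (hgρ hmem)).trans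
      (mul_le_mul_of_nonneg_left (hd t hmem) hL)
  · rw [nemytskii, nemytskii, indicator_of_notMem hmem, indicator_of_notMem hmem, sub_zero,
      norm_zero]
    exact mul_nonneg hL hd0

end Nemytskii

/-! ### The Volterra equation -/

section Volterra

variable {X : Type*} [NormedAddCommGroup X] [NormedSpace ℝ X] {F : ℝ → X → X} {T ρ C L : ℝ}
variable {U : Measure ℝ}

theorem IsCausalKernel.real_Iic_mono (hU : IsCausalKernel U) {s t : ℝ} (h : s ≤ t) :
    U.real (Iic s) ≤ U.real (Iic t) :=
  ENNReal.toReal_mono (hU.finite t).ne (measure_mono (Iic_subset_Iic.2 h))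

theorem IsCausal.holderOnWith_convolve {φ : ℝ → X} {M β t₀ K : ℝ} (hφ : IsCausal M φ)
    (hU : IsCausalKernel U)
    (hshift : ∀ h : ℝ, 0 < h → ∀ A : Set ℝ, MeasurableSet A → A ⊆ Ioi 0 →
      U ((fun x => x - h) ⁻¹' A) ≤ U A)
    (hβ : 0 < β) (hK : 0 ≤ K) (hmod : ∀ h, 0 < h → h < t₀ → U.real (Iic h) ≤ K * h ^ β)
    (hT : T < t₀) :
    HolderOnWith (2 * M * K).toNNReal β.toNNReal (convolve U φ) (Icc 0 T) := by
  have hM := hφ.nonneg_bound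
  have key : ∀ x ∈ Icc 0 T, ∀ y ∈ Icc 0 T, x < y →
      dist (convolve U φ x) (convolve U φ y) ≤ 2 * M * K * dist x y ^ β := by
    intro x hx y hy hxy
    have hh : 0 < y - x := sub_pos.2 hxy
    have h1 := hφ.norm_convolve_add_sub_le hU hshift (t := x) hh
    have h2 := hmod (y - x) hh (by linarith [hy.2, hx.1])
    rw [add_sub_cancel] at h1
    rw [dist_comm, dist_eq_norm, dist_comm, Real.dist_eq, abs_of_pos hh]
    refine h1.trans ?_
    rw [mul_assoc (2 * M)]
    exact mul_le_mul_of_nonneg_left h2 (by positivity)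
  have key' : ∀ x ∈ Icc 0 T, ∀ y ∈ Icc 0 T,
      dist (convolve U φ x) (convolve U φ y) ≤ 2 * M * K * dist x y ^ β := by
    intro x hx y hy
    rcases lt_trichotomy x y with h | h | h
    · exact key x hx y hy h
    · rw [h, dist_self]
      positivity
    · rw [dist_comm, dist_comm x y]
      exact key y hy x hx h
  intro x hx y hy
  have h := key' x hx y hy
  rw [edist_dist, edist_dist, ENNReal.ofReal_rpow_of_nonneg dist_nonneg (by positivity),
    show ((2 * M * K).toNNReal : ℝ≥0∞) = ENNReal.ofReal (2 * M * K) from rfl,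
    ← ENNReal.ofReal_mul (by positivity)]
  refine ENNReal.ofReal_le_ofReal ?_
  rw [Real.coe_toNNReal _ hβ.le]
  exact h

theorem IsCaratheodory.norm_convolve_nemytskii_sub_le (hF : IsCaratheodory F T ρ C L)
    (hU : IsCausalKernel U) (hC : 0 ≤ C) (hL : 0 ≤ L) (hT : 0 ≤ T) {f g : ℝ → X}
    (hf : ContinuousOn f (Icc 0 T)) (hg : ContinuousOn g (Icc 0 T))
    (hfρ : MapsTo f (Icc 0 T) (Metric.ball (0 : X) ρ))
    (hgρ : MapsTo g (Icc 0 T) (Metric.ball (0 : X) ρ)) {d : ℝ} (hd0 : 0 ≤ d)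
    (hd : ∀ t ∈ Icc 0 T, ‖f t - g t‖ ≤ d) (hV : L * U.real (Iic T) ≤ 1 / 2) {t : ℝ} (ht : t ≤ T) :
    ‖convolve U (nemytskii F T f) t - convolve U (nemytskii F T g) t‖ ≤ 1 / 2 * d := by
  have hf' := hF.isCausal_nemytskii hC hT hf hfρ
  have hg' := hF.isCausal_nemytskii hC hT hg hgρ
  rw [← convolve_sub hf' hg' hU]
  refine ((hf'.sub hg' (hF.norm_nemytskii_sub_le hL hfρ hgρ hd0 hd)).norm_convolve_le hU t).trans ?_
  have h1 := hU.real_Iic_mono ht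
  have h2 : L * U.real (Iic t) ≤ L * U.real (Iic T) := mul_le_mul_of_nonneg_left h1 hL
  nlinarith

/-- Uniqueness: at a maximum point of `‖f - g‖` the contraction estimate forces `f = g`. -/
theorem IsCaratheodory.eqOn_of_volterra (hF : IsCaratheodory F T ρ C L)
    (hU : IsCausalKernel U) (hC : 0 ≤ C) (hL : 0 ≤ L) (hT : 0 ≤ T) {f g : ℝ → X} {f₀ : X}
    (hf : ContinuousOn f (Icc 0 T)) (hg : ContinuousOn g (Icc 0 T))
    (hfρ : MapsTo f (Icc 0 T) (Metric.ball (0 : X) ρ))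
    (hgρ : MapsTo g (Icc 0 T) (Metric.ball (0 : X) ρ)) (hV : L * U.real (Iic T) ≤ 1 / 2)
    (hfe : ∀ t ∈ Icc 0 T, f t = f₀ + convolve U (nemytskii F T f) t)
    (hge : ∀ t ∈ Icc 0 T, g t = f₀ + convolve U (nemytskii F T g) t) : EqOn f g (Icc 0 T) := by
  obtain ⟨s, hs, hmax⟩ := isCompact_Icc.exists_isMaxOn (nonempty_Icc.2 hT) (hf.sub hg).norm
  have hd : ∀ t ∈ Icc 0 T, ‖f t - g t‖ ≤ ‖f s - g s‖ := fun t ht => hmax ht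
  have h := hF.norm_convolve_nemytskii_sub_le hU hC hL hT hf hg hfρ hgρ (norm_nonneg _) hd hV hs.2
  rw [← add_sub_add_left_eq_sub _ _ f₀, ← hfe s hs, ← hge s hs] at h
  intro t ht
  have h1 := hd t ht
  have h2 := norm_nonneg (f t - g t)
  exact sub_eq_zero.1 (norm_eq_zero.1 (by linarith))

/-- Existence, by Banach's fixed point theorem among the continuous functions on `[0, T]` with values
in the closed ball. The equation defines `f` on the whole line. -/
theorem IsCaratheodory.exists_volterra [CompleteSpace X] (hF : IsCaratheodory F T ρ C L)
    (hU : IsCausalKernel U) (hC : 0 ≤ C) (hL : 0 ≤ L) (hT : 0 ≤ T) {f₀ : X} {r : ℝ} (hr : 0 ≤ r)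
    (hball : Metric.closedBall f₀ r ⊆ Metric.ball 0 ρ)
    (hcont : ∀ φ : ℝ → X, IsCausal C φ → ContinuousOn (convolve U φ) (Icc 0 T))
    (hVC : C * U.real (Iic T) ≤ r) (hV : L * U.real (Iic T) ≤ 1 / 2) :
    ∃ f : ℝ → X, ContinuousOn f (Icc 0 T) ∧ MapsTo f (Icc 0 T) (Metric.closedBall f₀ r) ∧
      ∀ t, f t = f₀ + convolve U (nemytskii F T f) t := by
  let E := {u : C(Icc 0 T, X) // ∀ t, u t ∈ Metric.closedBall f₀ r}
  have hclosed : IsClosed {u : C(Icc 0 T, X) | ∀ t, u t ∈ Metric.closedBall f₀ r} := by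
    simp only [ofPred_forall]
    exact isClosed_iInter fun t => Metric.isClosed_closedBall.preimage
      (continuous_eval_const t)
  have hcomplete : CompleteSpace E := hclosed.completeSpace_coe
  have hne : Nonempty E := ⟨⟨ContinuousMap.const _ f₀, fun t => Metric.mem_closedBall_self hr⟩⟩
  have hnei : Nonempty (Icc (0 : ℝ) T) := ⟨⟨0, le_rfl, hT⟩⟩
  let ext : E → ℝ → X := fun u t => u.1 (projIcc 0 T hT t)
  have hextc : ∀ u : E, ContinuousOn (ext u) (Icc 0 T) := fun u =>
    (u.1.continuous.comp continuous_projIcc).continuousOn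
  have hextρ : ∀ u : E, MapsTo (ext u) (Icc 0 T) (Metric.ball (0 : X) ρ) := fun u t _ =>
    hball (u.2 _)
  have hcausal := fun u : E => hF.isCausal_nemytskii hC hT (hextc u) (hextρ u)
  have hmem : ∀ (u : E) (t : ℝ), t ≤ T →
      f₀ + convolve U (nemytskii F T (ext u)) t ∈ Metric.closedBall f₀ r := by
    intro u t ht
    rw [mem_closedBall_iff_norm, add_sub_cancel_left]
    exact ((hcausal u).norm_convolve_le hU t).trans
      ((mul_le_mul_of_nonneg_left (hU.real_Iic_mono ht) hC).trans hVC)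
  let Γ : E → E := fun u => ⟨⟨fun t => f₀ + convolve U (nemytskii F T (ext u)) t,
    continuous_const.add (continuousOn_iff_continuous_domRestrict.1 (hcont _ (hcausal u)))⟩,
    fun t => hmem u t t.2.2⟩
  have hΓ : ContractingWith (1 / 2) Γ := by
    refine ⟨by rw [← NNReal.coe_lt_coe]; norm_num, LipschitzWith.of_dist_le_mul fun u v => ?_⟩
    have hd : ∀ t ∈ Icc 0 T, ‖ext u t - ext v t‖ ≤ dist u v := fun t _ => by
      rw [← dist_eq_norm]
      exact ContinuousMap.dist_apply_le_dist _
    rw [Subtype.dist_eq, ContinuousMap.dist_le (by positivity)]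
    intro t
    have h := hF.norm_convolve_nemytskii_sub_le hU hC hL hT (hextc u) (hextc v) (hextρ u) (hextρ v)
      dist_nonneg hd hV t.2.2
    rw [dist_eq_norm]
    simp only [Γ, ContinuousMap.coe_mk, add_sub_add_left_eq_sub]
    simpa using h
  obtain ⟨u, hu⟩ : ∃ u, Γ u = u := ⟨_, hΓ.fixedPoint_isFixedPt⟩
  set f : ℝ → X := fun t => f₀ + convolve U (nemytskii F T (ext u)) t with hf
  have hfu : EqOn f (ext u) (Icc 0 T) := by
    intro t ht
    have h := congrArg (fun w : E => w.1 ⟨t, ht⟩) hu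
    simp only [ext, projIcc_of_mem hT ht]
    exact h
  refine ⟨f, (hextc u).congr hfu, fun t ht => hmem u t ht.2, fun t => ?_⟩
  rw [nemytskii_congr hfu]

end Volterra

/-! ### Equivalence of the Cauchy problem and the Volterra equation -/

section Equivalence

variable {X : Type*} [NormedAddCommGroup X] [NormedSpace ℝ X] {F : ℝ → X → X} {T ρ C L : ℝ}
variable {U ν : Measure ℝ} {Φ : ℝ → ℝ}

theorem IsCausal.lipschitzWith_integral {φ : ℝ → X} {M : ℝ} (hφ : IsCausal M φ) :
    LipschitzWith M.toNNReal fun t => ∫ s in (0 : ℝ)..t, φ s := by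
  refine LipschitzWith.of_dist_le_mul fun x y => ?_
  rw [dist_eq_norm, intervalIntegral.integral_interval_sub_left (hφ.intervalIntegrable _ _)
    (hφ.intervalIntegrable _ _), Real.coe_toNNReal _ hφ.nonneg_bound, Real.dist_eq]
  exact intervalIntegral.norm_integral_le_of_norm_le_const_ae (hφ.bound.mono fun t ht _ => ht)

theorem IsCausal.ae_hasDerivAt_integral [CompleteSpace X] {φ : ℝ → X} {M : ℝ}
    (hφ : IsCausal M φ) : ∀ᵐ t, HasDerivAt (fun t => ∫ s in (0 : ℝ)..t, φ s) (φ t) t := by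
  have hloc : LocallyIntegrable φ volume := by
    refine (locallyIntegrable_const M).mono hφ.aestronglyMeasurable ?_
    exact hφ.bound.mono fun t ht => ht.trans (le_abs_self M)
  filter_upwards [LocallyIntegrable.ae_hasDerivAt_integral hloc] with t ht using ht 0

/-- A solution of the Volterra equation solves the Cauchy problem: convolving `U * φ` with the tail
of the Lévy measure gives the primitive of `φ`. -/
theorem isSolution_of_volterra [CompleteSpace X] (hν : IsLevyTriple Φ 0 0 ν)
    (hU : IsCausalKernel U) (hconv : Measure.conv U (tailMeasure ν) = volume.restrict (Ioi 0))
    {f : ℝ → X} {f₀ : X} (hφ : IsCausal C (nemytskii F T f))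
    (hcont : ContinuousOn (convolve U (nemytskii F T f)) (Icc 0 T)) (hT : 0 < T)
    (hf : ∀ t, f t = f₀ + convolve U (nemytskii F T f) t) : IsSolution ν F f₀ T f := by
  set φ := nemytskii F T f with hφdef
  have hN := hν.isCausalKernel_tailMeasure
  have hsU := hU.sigmaFinite
  have hf0 : f 0 = f₀ := by rw [hf 0, hφ.convolve_of_nonpos hU le_rfl, add_zero]
  have hsub : ∀ s, f s - f 0 = convolve U φ s := fun s => by rw [hf0, hf s, add_sub_cancel_left]
  -- `U * φ` on `[0, T]`, cut off outside, so that it is bounded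
  set w : ℝ → X := (Icc 0 T).indicator (convolve U φ) with hw
  have hwc : IsCausal (C * U.real (Iic T)) w := by
    refine ⟨(aestronglyMeasurable_indicator_iff measurableSet_Icc).2
      (hcont.aestronglyMeasurable measurableSet_Icc), ae_of_all _ fun t => ?_, fun t ht =>
      indicator_of_notMem (fun h => absurd h.1 (not_le.2 ht)) _⟩
    by_cases ht : t ∈ Icc 0 T
    · rw [hw, indicator_of_mem ht]
      exact (hφ.norm_convolve_le hU t).trans
        (mul_le_mul_of_nonneg_left (hU.real_Iic_mono ht.2) hφ.nonneg_bound)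
    · rw [hw, indicator_of_notMem ht, norm_zero]
      exact mul_nonneg hφ.nonneg_bound ENNReal.toReal_nonneg
  have hww : ∀ s, s ≤ T → convolve U φ s = w s := by
    intro s hs
    by_cases h0 : 0 ≤ s
    · rw [hw, indicator_of_mem (show s ∈ Icc 0 T from ⟨h0, hs⟩)]
    · rw [hw, indicator_of_notMem fun h => h0 h.1, hφ.convolve_of_nonpos hU (not_le.1 h0).le]
  have hprim : ∀ t ∈ Icc 0 T, caputoPrimitive ν f t = ∫ s in (0 : ℝ)..t, φ s := by
    intro t ht
    have h1 : caputoPrimitive ν f t = ∫ s in (0 : ℝ)..t, levyTail ν (t - s) • w s := by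
      refine intervalIntegral.integral_congr fun s hs => ?_
      rw [uIcc_of_le ht.1] at hs
      simp only [hsub, hww s (hs.2.trans ht.2)]
    rw [h1, ← hwc.convolve_tailMeasure hν ht.1,
      ← convolve_congr hN fun s hs => hww s (hs.trans ht.2), hφ.convolve_convolve hN hU,
      Measure.conv_comm, hconv, hφ.convolve_restrict_Ioi ht.1]
  refine ⟨hf0, fun t ht => ?_, ?_, ?_⟩
  · refine (hwc.intervalIntegrable_levyTail_smul hν ht.1).congr fun s hs => ?_
    rw [uIoc_of_le ht.1] at hs
    simp only [hsub, hww s (hs.2.trans ht.2)]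
  · refine LipschitzOnWith.absolutelyContinuousOnInterval (K := C.toNNReal) fun x hx y hy => ?_
    rw [uIcc_of_le hT.le] at hx hy
    rw [hprim x hx, hprim y hy]
    exact hφ.lipschitzWith_integral x y
  · rw [← restrict_Ioo_eq_restrict_Icc]
    filter_upwards [ae_restrict_of_ae hφ.ae_hasDerivAt_integral,
      ae_restrict_mem measurableSet_Ioo] with t ht htm
    have h1 : φ t = F t (f t) := by
      rw [hφdef, nemytskii, indicator_of_mem (Ioo_subset_Icc_self htm)]
    rw [← h1]
    refine ht.congr_of_eventuallyEq ?_
    filter_upwards [Ioo_mem_nhds htm.1 htm.2] with s hs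
    exact hprim s (Ioo_subset_Icc_self hs)

/-- Continuous functions on `[0, T]` with the same primitive are equal. -/
theorem eqOn_Icc_of_integral_eq [CompleteSpace X] {v w : ℝ → X} {M M' : ℝ} (hv : IsCausal M v)
    (hw : IsCausal M' w) (hvc : ContinuousOn v (Icc 0 T)) (hwc : ContinuousOn w (Icc 0 T))
    (hT : 0 < T) (h : ∀ t ∈ Icc 0 T, ∫ s in (0 : ℝ)..t, v s = ∫ s in (0 : ℝ)..t, w s) :
    EqOn v w (Icc 0 T) := by
  refine Measure.eqOn_Icc_of_ae_eq volume hT.ne ?_ hvc hwc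
  rw [← restrict_Ioo_eq_restrict_Icc]
  filter_upwards [ae_restrict_of_ae hv.ae_hasDerivAt_integral,
    ae_restrict_of_ae hw.ae_hasDerivAt_integral, ae_restrict_mem measurableSet_Ioo] with t h1 h2 ht
  refine h1.unique (h2.congr_of_eventuallyEq ?_)
  filter_upwards [Ioo_mem_nhds ht.1 ht.2] with s hs
  exact h s (Ioo_subset_Icc_self hs)

/-- A continuous bounded solution of the Cauchy problem solves the Volterra equation: the equation
integrates to `ν̄ * (f - f₀) = ∫ φ`, and convolving with `U` gives `∫ (f - f₀) = ∫ U * φ`. -/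
theorem volterra_of_isSolution [CompleteSpace X] (hν : IsLevyTriple Φ 0 0 ν)
    (hU : IsCausalKernel U) (hconv : Measure.conv U (tailMeasure ν) = volume.restrict (Ioi 0))
    {f : ℝ → X} {f₀ : X} (hφ : IsCausal C (nemytskii F T f))
    (hcont : ContinuousOn (convolve U (nemytskii F T f)) (Icc 0 T)) (hT : 0 < T)
    (hfc : ContinuousOn f (Icc 0 T)) (hsol : IsSolution ν F f₀ T f) :
    ∀ t ∈ Icc 0 T, f t = f₀ + convolve U (nemytskii F T f) t := by
  set φ := nemytskii F T f with hφdef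
  have hN := hν.isCausalKernel_tailMeasure
  have hLeb := isCausalKernel_restrict_Ioi
  have hsU := hU.sigmaFinite
  obtain ⟨M, hM⟩ := isCompact_Icc.exists_bound_of_continuousOn (hfc.sub continuousOn_const)
    (f := fun t => f t - f₀)
  obtain ⟨M', hM'⟩ := isCompact_Icc.exists_bound_of_continuousOn hcont
  have hcut : ∀ {v : ℝ → X} {M : ℝ}, ContinuousOn v (Icc 0 T) → (∀ t ∈ Icc 0 T, ‖v t‖ ≤ M) →
      IsCausal M ((Icc 0 T).indicator v) := by
    intro v M hv hb
    refine ⟨(aestronglyMeasurable_indicator_iff measurableSet_Icc).2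
      (hv.aestronglyMeasurable measurableSet_Icc), ae_of_all _ fun t => ?_, fun t ht =>
      indicator_of_notMem (fun h => absurd h.1 (not_le.2 ht)) _⟩
    by_cases ht : t ∈ Icc 0 T
    · rw [indicator_of_mem ht]
      exact hb t ht
    · rw [indicator_of_notMem ht, norm_zero]
      exact (norm_nonneg _).trans (hb 0 ⟨le_rfl, hT.le⟩)
  set g : ℝ → X := (Icc 0 T).indicator (fun t => f t - f₀) with hg
  set w : ℝ → X := (Icc 0 T).indicator (convolve U φ) with hw
  have hgc : IsCausal M g := hcut (hfc.sub continuousOn_const) hM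
  have hwc : IsCausal M' w := hcut hcont hM'
  have hgE : EqOn g (fun t => f t - f₀) (Icc 0 T) := fun t ht => indicator_of_mem ht _
  have hwE : EqOn w (convolve U φ) (Icc 0 T) := fun t ht => indicator_of_mem ht _
  have hww : ∀ s, s ≤ T → convolve U φ s = w s := by
    intro s hs
    by_cases h0 : 0 ≤ s
    · exact (hwE ⟨h0, hs⟩).symm
    · rw [hw, indicator_of_notMem fun h => h0 h.1, hφ.convolve_of_nonpos hU (not_le.1 h0).le]
  have hprim : ∀ t ∈ Icc 0 T, caputoPrimitive ν f t = convolve (tailMeasure ν) g t := by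
    intro t ht
    rw [hgc.convolve_tailMeasure hν ht.1]
    refine intervalIntegral.integral_congr fun s hs => ?_
    rw [uIcc_of_le ht.1] at hs
    simp only [hgE ⟨hs.1, hs.2.trans ht.2⟩, hsol.initial]
  -- the integrated equation
  have hint : ∀ t ∈ Icc 0 T, caputoPrimitive ν f t = ∫ s in (0 : ℝ)..t, φ s := by
    have hac := hsol.equation.absCts.sub
      hφ.lipschitzWith_integral.lipschitzOnWith.absolutelyContinuousOnInterval
    have hder := hsol.equation.hasDerivAt
    rw [ae_restrict_iff' measurableSet_Icc] at hder
    obtain ⟨c, hc⟩ := hac.const_of_ae_hasDerivAt_zero (by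
      filter_upwards [hder, hφ.ae_hasDerivAt_integral] with t h1 h2 ht
      rw [uIcc_of_le hT.le] at ht
      have h3 : φ t = F t (f t) := by rw [hφdef, nemytskii, indicator_of_mem ht]
      have h4 := (h1 ht).sub h2
      rwa [h3, sub_self] at h4)
    rw [uIcc_of_le hT.le] at hc
    have hc0 : c = 0 := by
      rw [← hc 0 ⟨le_rfl, hT.le⟩]
      simp [caputoPrimitive]
    intro t ht
    have := hc t ht
    rw [hc0] at this
    exact sub_eq_zero.1 this
  have hconvs : ∀ s, s ≤ T →
      convolve (tailMeasure ν) g s = convolve (volume.restrict (Ioi 0)) φ s := by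
    intro s hs
    by_cases h0 : 0 ≤ s
    · rw [← hprim s ⟨h0, hs⟩, hint s ⟨h0, hs⟩, hφ.convolve_restrict_Ioi h0]
    · rw [hgc.convolve_of_nonpos hN (not_le.1 h0).le, hφ.convolve_of_nonpos hLeb (not_le.1 h0).le]
  have hprims : ∀ t ∈ Icc 0 T, ∫ s in (0 : ℝ)..t, g s = ∫ s in (0 : ℝ)..t, w s := by
    intro t ht
    calc ∫ s in (0 : ℝ)..t, g s = convolve (volume.restrict (Ioi 0)) g t :=
          (hgc.convolve_restrict_Ioi ht.1).symm
      _ = convolve U (convolve (tailMeasure ν) g) t := by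
          rw [hgc.convolve_convolve hU hN, hconv]
      _ = convolve U (convolve (volume.restrict (Ioi 0)) φ) t :=
          convolve_congr hU fun s hs => hconvs s (hs.trans ht.2)
      _ = convolve (volume.restrict (Ioi 0)) (convolve U φ) t := by
          rw [hφ.convolve_convolve hU hLeb, hφ.convolve_convolve hLeb hU, Measure.conv_comm]
      _ = convolve (volume.restrict (Ioi 0)) w t :=
          convolve_congr hLeb fun s hs => hww s (hs.trans ht.2)
      _ = ∫ s in (0 : ℝ)..t, w s := hwc.convolve_restrict_Ioi ht.1
  intro t ht
  have h := eqOn_Icc_of_integral_eq hgc hwc ((hfc.sub continuousOn_const).congr hgE)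
    (hcont.congr hwE) hT hprims ht
  rw [hgE ht, hwE ht] at h
  rw [← h, add_sub_cancel]

end Equivalence

end GenCaputo

theorem theorem3p1 {X : Type*} [NormedAddCommGroup X] [NormedSpace ℝ X] [CompleteSpace X]
    {Ω : Type*} [MeasurableSpace Ω] (P : Measure Ω) [IsProbabilityMeasure P]
    (Φ : ℝ → ℝ) (ν : Measure ℝ) (σ : ℝ≥0 → Ω → ℝ) (β : ℝ)
    (hσ : GenCaputo.IsSubordinator σ P) (hσΦ : GenCaputo.HasLaplaceExponent σ P Φ)
    (hΦ : GenCaputo.StandingAssumption Φ ν σ P β)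
    (T : ℝ) (hT : 0 < T) (F : ℝ → X → X)
    (hF : ∀ x, AEStronglyMeasurable (fun t => F t x) (volume.restrict (Icc 0 T)))
    (A1 : ∀ R > (0 : ℝ), ∃ C > (0 : ℝ), ∀ᵐ t ∂(volume.restrict (Icc 0 T)),
      ∀ x ∈ Metric.ball (0 : X) R, ‖F t x‖ ≤ C)
    (A2 : ∀ R > (0 : ℝ), ∃ L > (0 : ℝ), ∀ᵐ t ∂(volume.restrict (Icc 0 T)),
      ∀ x ∈ Metric.ball (0 : X) R, ∀ z ∈ Metric.ball (0 : X) R, ‖F t x - F t z‖ ≤ L * ‖x - z‖)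
    (f₀ : X) (R : ℝ) (hR : 0 < R) :
    ∃ T' : ℝ, 0 < T' ∧ T' ≤ T ∧ ∃ f : ℝ → X,
      (GenCaputo.IsHolderInto β T' (Metric.ball f₀ R) f ∧ GenCaputo.IsSolution ν F f₀ T' f) ∧
      ∀ g : ℝ → X,
        GenCaputo.IsHolderInto β T' (Metric.ball f₀ R) g ∧ GenCaputo.IsSolution ν F f₀ T' g →
          EqOn g f (Icc 0 T') := by
  open Filter Topology GenCaputo in
  obtain ⟨t₀, ht₀, K, hK, hmod⟩ := hΦ.exists_measure_Iic_le hσ hσΦ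
  have hβ := hΦ.exponent_mem
  have hU := hΦ.isCausalKernel hσ hσΦ
  have hshift := hΦ.measure_preimage_sub_le hσ hσΦ
  have hconv := hΦ.conv_eq hσ hσΦ
  set U := potentialMeasure σ P
  have hball : Metric.ball f₀ R ⊆ Metric.ball 0 (‖f₀‖ + R) :=
    Metric.ball_subset_ball' (by rw [dist_zero_right, add_comm])
  have hρ : 0 < ‖f₀‖ + R := by positivity
  obtain ⟨C, hC, hA1⟩ := A1 _ hρ
  obtain ⟨L, hL, hA2⟩ := A2 _ hρ
  have hlim : ∀ c : ℝ, Tendsto (fun h : ℝ => c * (K * h ^ β)) (𝓝[>] 0) (𝓝 0) := by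
    intro c
    have h1 : ContinuousAt (fun h : ℝ => c * (K * h ^ β)) 0 :=
      ((Real.continuousAt_rpow_const 0 β (Or.inr hβ.1.le)).const_mul K).const_mul c
    have h2 := h1.tendsto.mono_left (nhdsWithin_le_nhds (s := Ioi (0 : ℝ)))
    simpa [Real.zero_rpow hβ.1.ne'] using h2
  -- on `[0, T']` the integral operator takes values within `R / 2` of `f₀` and halves distances
  obtain ⟨T', hT'0, hT't₀, hT'T, hT'C, hT'L⟩ : ∃ T' : ℝ, 0 < T' ∧ T' < t₀ ∧ T' ≤ T ∧
      C * (K * T' ^ β) ≤ R / 2 ∧ L * (K * T' ^ β) ≤ 1 / 2 := by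
    have h1 : ∀ᶠ h in 𝓝[>] (0 : ℝ), 0 < h := self_mem_nhdsWithin
    have h2 : ∀ᶠ h in 𝓝[>] (0 : ℝ), h < t₀ := nhdsWithin_le_nhds (Iio_mem_nhds ht₀)
    have h3 : ∀ᶠ h in 𝓝[>] (0 : ℝ), h ≤ T := nhdsWithin_le_nhds (Iic_mem_nhds hT)
    have h4 := (hlim C).eventually_le_const (show (0 : ℝ) < R / 2 by positivity)
    have h5 := (hlim L).eventually_le_const (show (0 : ℝ) < 1 / 2 by positivity)
    exact (h1.and (h2.and (h3.and (h4.and h5)))).exists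
  have hV := hmod T' hT'0 hT't₀
  have hcar : IsCaratheodory F T' (‖f₀‖ + R) C L := IsCaratheodory.mono ⟨hF, hA1, hA2⟩ hT'T
  have hhol : ∀ φ : ℝ → X, IsCausal C φ →
      HolderOnWith (2 * C * K).toNNReal β.toNNReal (convolve U φ) (Icc 0 T') := fun φ hφ =>
    hφ.holderOnWith_convolve hU hshift hβ.1 hK.le hmod hT't₀
  have hcont : ∀ φ : ℝ → X, IsCausal C φ → ContinuousOn (convolve U φ) (Icc 0 T') := fun φ hφ =>
    (hhol φ hφ).continuousOn (Real.toNNReal_pos.2 hβ.1)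
  have hVC : C * U.real (Iic T') ≤ R / 2 := (mul_le_mul_of_nonneg_left hV hC.le).trans hT'C
  have hVL : L * U.real (Iic T') ≤ 1 / 2 := (mul_le_mul_of_nonneg_left hV hL.le).trans hT'L
  have hsub : Metric.closedBall f₀ (R / 2) ⊆ Metric.ball f₀ R :=
    Metric.closedBall_subset_ball (by linarith)
  obtain ⟨f, hfc, hfm, hfe⟩ := hcar.exists_volterra hU hC.le hL.le hT'0.le (r := R / 2)
    (by positivity) (hsub.trans hball) hcont hVC hVL
  have hfφ := hcar.isCausal_nemytskii hC.le hT'0.le hfc fun t ht => hball (hsub (hfm ht))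
  refine ⟨T', hT'0, hT'T, f, ⟨⟨fun t ht => hsub (hfm ht), (2 * C * K).toNNReal, ?_⟩,
    isSolution_of_volterra hΦ.levy hU hconv hfφ (hcont _ hfφ) hT'0 hfe⟩, ?_⟩
  · intro x hx y hy
    rw [hfe x, hfe y, edist_add_left]
    exact hhol _ hfφ x hx y hy
  · rintro g ⟨⟨hgm, Lg, hgL⟩, hgs⟩
    have hgc := hgL.continuousOn (Real.toNNReal_pos.2 hβ.1)
    have hgφ := hcar.isCausal_nemytskii hC.le hT'0.le hgc fun t ht => hball (hgm ht)
    exact hcar.eqOn_of_volterra hU hC.le hL.le hT'0.le hgc hfc (fun t ht => hball (hgm ht))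
      (fun t ht => hball (hsub (hfm ht))) hVL
      (volterra_of_isSolution hΦ.levy hU hconv hgφ (hcont _ hgφ) hT'0 hgc hgs)
      fun t _ => hfe t
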